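/- Let $n,p,q$ be natural numbers with $q\ge 1$ and $p\ge 2q+3$, let $X\in\mathbb R^{n\times p}$ be a fixed design matrix of full column rank $p$ (so $n\ge p$) with rows $x_1^\top,\dots,x_n^\top$, and let $\Sigma\in\mathbb R^{q\times q}$ be a known positive definite matrix. Consider the multivariate linear regression model $$y_i=B^\top x_i+\varepsilon_i,\qquad \varepsilon_i\sim \mathrm N_q(0,\Sigma)\ \text{independent},\qquad i=1,\dots,n,$$ with unknown parameter $B\in\mathbb R^{p\times q}$. Write $Y=(y_1,\dots,y_n)^\top\in\mathbb R^{n\times q}$, let $p(Y\mid B,\Sigma)$ be its density and $\mathrm E_B$ the expectation under $B$. Let $\hat B=(X^\top X)^{-1}X^\top Y$ be the maximum likelihood estimate, let $$d=d((B,\Sigma),(\hat B,\Sigma))=-2\int p(\widetilde Y\mid B,\Sigma)\,\log p(\widetilde Y\mid \hat B,\Sigma)\,\mathrm d\widetilde Y$$ be the Kullback--Leibler discrepancy of the plug-in predictive density, and let $$\mathrm{AIC}=-2\log p(Y\mid\hat B,\Sigma)+2pq,\qquad \mathrm{MAIC}=\mathrm{AIC}-\frac{2(p-2q-2)}{q}\,\mathrm{tr}\!\left(\Sigma\,\big((X\hat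 B)^\top (X\hat B)\big)^{-1}\right).$$ A (measurable) function $\lambda_1(Y)$ dominates another one $\lambda_2(Y)$ as an estimator of $d$ if $\mathrm E_B[(\lambda_1(Y)-d)^2]\le \mathrm E_B[(\lambda_2(Y)-d)^2]$ for every $B$, with strict inequality for at least one $B$; $\lambda_2$ is inadmissible if some $\lambda_1$ dominates it. Then AIC is inadmissible as an estimator of $d$ and is dominated by MAIC; moreover, the inequality is strict everywhere: $$\mathrm E_B[(\mathrm{MAIC}-d)^2]<\mathrm E_B[(\mathrm{AIC}-d)^2]\qquad\text{for every }B\in\mathbb R^{p\times q}.$$ -/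

import Mathlib

open MeasureTheory ProbabilityTheory Matrix
open scoped ENNReal

namespace LossEstimation

/-! ### Loss estimation

A statistical model is a family `P : Θ → Measure 𝓨` of laws of the observation.  The quantity to be
estimated is `L θ y`, which depends on the parameter and on the observation. -/

/-- Mean squared error `E_θ[(l(Y) - L(θ, Y))²]`, with values in `[0, ∞]`. -/
noncomputable def risk {Θ 𝓨 : Type*} [MeasurableSpace 𝓨] (P : Θ → Measure 𝓨)
    (L : Θ → 𝓨 → ℝ) (l : 𝓨 → ℝ) (θ : Θ) : ℝ≥0∞ :=
  ∫⁻ y, ENNReal.ofReal ((l y - L θ y) ^ 2) ∂(P θ)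

/-- `Dominates P L l₁ l₂`: the loss estimator `l₁` dominates the loss estimator `l₂`.  Loss
estimators are measurable functions of the observation. -/
def Dominates {Θ 𝓨 : Type*} [MeasurableSpace 𝓨] (P : Θ → Measure 𝓨)
    (L : Θ → 𝓨 → ℝ) (l₁ l₂ : 𝓨 → ℝ) : Prop :=
  Measurable l₁ ∧ Measurable l₂ ∧
    (∀ θ, risk P L l₁ θ ≤ risk P L l₂ θ) ∧ ∃ θ, risk P L l₁ θ < risk P L l₂ θ

/-- A loss estimator is admissible if no loss estimator dominates it. -/
def IsAdmissible {Θ 𝓨 : Type*} [MeasurableSpace 𝓨] (P : Θ → Measure 𝓨)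
    (L : Θ → 𝓨 → ℝ) (l : 𝓨 → ℝ) : Prop :=
  ¬ ∃ l' : 𝓨 → ℝ, Dominates P L l' l

/-- A loss estimator is inadmissible if it is not admissible. -/
def IsInadmissible {Θ 𝓨 : Type*} [MeasurableSpace 𝓨] (P : Θ → Measure 𝓨)
    (L : Θ → 𝓨 → ℝ) (l : 𝓨 → ℝ) : Prop :=
  ¬ IsAdmissible P L l

/-- The Kullback–Leibler discrepancy `-2 ∫ f(ỹ) log g(ỹ) dỹ` from the density `f` to the
density `g`. -/
noncomputable def klDiscrepancy {𝓨 : Type*} [MeasureSpace 𝓨] (f g : 𝓨 → ℝ) : ℝ :=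
  -2 * ∫ y, f y * Real.log (g y)

end LossEstimation

namespace Regression

/-! ### Multivariate linear regression `yᵢ = Bᵀ xᵢ + εᵢ`, `εᵢ ∼ N_q(0, S)` independent -/

/-- The observation `(y₁, …, yₙ)`, with `yᵢ ∈ ℝ^q`. -/
abbrev Sample (n q : ℕ) : Type := Fin n → EuclideanSpace ℝ (Fin q)

/-- The `n × q` matrix `Y = (y₁, …, yₙ)ᵀ`. -/
def responseMatrix {n q : ℕ} (y : Sample n q) : Matrix (Fin n) (Fin q) ℝ :=
  Matrix.of fun i j => y i j

/-- The mean `Bᵀ xᵢ` of `yᵢ`, where `xᵢ` is the `i`-th row of the design matrix `X`. -/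
noncomputable def meanVector {n p q : ℕ} (X : Matrix (Fin n) (Fin p) ℝ)
    (B : Matrix (Fin p) (Fin q) ℝ) (i : Fin n) : EuclideanSpace ℝ (Fin q) :=
  WithLp.toLp 2 (Bᵀ *ᵥ X i)

/-- The law of `(y₁, …, yₙ)`: independent, with `yᵢ ∼ N_q(Bᵀ xᵢ, S)`. -/
noncomputable def law {n p q : ℕ} (X : Matrix (Fin n) (Fin p) ℝ)
    (S : Matrix (Fin q) (Fin q) ℝ) (B : Matrix (Fin p) (Fin q) ℝ) : Measure (Sample n q) :=
  Measure.pi fun i => multivariateGaussian (meanVector X B i) S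

/-- The Lebesgue density of `N_q(m, S)`, for `S` positive definite. -/
noncomputable def gaussianDensity {q : ℕ} (m : EuclideanSpace ℝ (Fin q))
    (S : Matrix (Fin q) (Fin q) ℝ) (v : EuclideanSpace ℝ (Fin q)) : ℝ :=
  (√((2 * Real.pi) ^ q * S.det))⁻¹ *
    Real.exp (-((v - m).ofLp ⬝ᵥ S⁻¹ *ᵥ (v - m).ofLp) / 2)

/-- The density `p(Y ∣ B, S)` of `law X S B`. -/
noncomputable def density {n p q : ℕ} (X : Matrix (Fin n) (Fin p) ℝ)
    (S : Matrix (Fin q) (Fin q) ℝ) (B : Matrix (Fin p) (Fin q) ℝ) (y : Sample n q) : ℝ :=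
  ∏ i, gaussianDensity (meanVector X B i) S (y i)

/-! The function `density X S B` is the Lebesgue density of `law X S B`. -/

theorem lintegral_pi_ofReal_prod {ι : Type*} [Fintype ι] {E : ι → Type*} [∀ i, MeasureSpace (E i)]
    [∀ i, SigmaFinite (volume : Measure (E i))]
    (f : ∀ i, E i → ℝ) (hf : ∀ i, Integrable (f i)) (hf0 : ∀ i x, 0 ≤ f i x) :
    ∫⁻ x : ∀ i, E i, ENNReal.ofReal (∏ i, f i (x i)) = ∏ i, ∫⁻ x, ENNReal.ofReal (f i x) := by
  rw [volume_pi, ← ofReal_integral_eq_lintegral_ofReal (Integrable.fintype_prod_dep hf)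
    (Filter.Eventually.of_forall fun x => Finset.prod_nonneg fun i _ => hf0 i _)]
  rw [integral_fintype_prod_eq_prod f, ENNReal.ofReal_prod_of_nonneg
    (fun i _ => integral_nonneg (hf0 i))]
  refine Finset.prod_congr rfl fun i _ => ?_
  rw [← ofReal_integral_eq_lintegral_ofReal (hf i) (Filter.Eventually.of_forall (hf0 i))]

theorem pi_withDensity_ofReal {ι : Type*} [Fintype ι] {E : ι → Type*} [∀ i, MeasureSpace (E i)]
    [∀ i, SigmaFinite (volume : Measure (E i))]
    (f : ∀ i, E i → ℝ) (hf : ∀ i, Integrable (f i)) (hf0 : ∀ i x, 0 ≤ f i x) :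
    Measure.pi (fun i => (volume : Measure (E i)).withDensity fun x => ENNReal.ofReal (f i x)) =
      (volume : Measure (∀ i, E i)).withDensity fun x => ENNReal.ofReal (∏ i, f i (x i)) := by
  have : ∀ i, IsFiniteMeasure
      ((volume : Measure (E i)).withDensity fun x => ENNReal.ofReal (f i x)) := fun i =>
    isFiniteMeasure_withDensity_ofReal (hf i).2
  refine Measure.pi_eq fun s hs => ?_
  rw [withDensity_apply _ (MeasurableSet.univ_pi hs),
    ← lintegral_indicator (MeasurableSet.univ_pi hs)]
  simp_rw [withDensity_apply _ (hs _), ← lintegral_indicator (hs _)]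
  have h := lintegral_pi_ofReal_prod (fun i => (s i).indicator (f i)) (fun i => (hf i).indicator (hs i))
    (fun i x => Set.indicator_nonneg (fun _ _ => hf0 i _) _)
  have h1 : ∀ x : ∀ i, E i, (Set.univ.pi s).indicator
      (fun x => ENNReal.ofReal (∏ i, f i (x i))) x =
      ENNReal.ofReal (∏ i, (s i).indicator (f i) (x i)) := fun x => by
    by_cases hx : x ∈ Set.univ.pi s
    · rw [Set.indicator_of_mem hx]
      congr 1
      exact Finset.prod_congr rfl fun i _ => (Set.indicator_of_mem (hx i trivial) _).symm
    · rw [Set.indicator_of_notMem hx]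
      simp only [Set.mem_pi, Set.mem_univ, true_imp_iff, not_forall] at hx
      obtain ⟨i, hi⟩ := hx
      rw [Finset.prod_eq_zero (Finset.mem_univ i) (Set.indicator_of_notMem hi _)]
      simp
  have h2 : ∀ i x, (s i).indicator (fun x => ENNReal.ofReal (f i x)) x =
      ENNReal.ofReal ((s i).indicator (f i) x) := fun i x => by
    by_cases hx : x ∈ s i <;> simp [hx]
  simp_rw [h1, h2, h]

theorem stdGaussian_eq_withDensity (q : ℕ) :
    stdGaussian (EuclideanSpace ℝ (Fin q)) = volume.withDensity fun v =>
      ENNReal.ofReal (gaussianDensity 0 1 v) := by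
  rw [← map_pi_eq_stdGaussian]
  simp_rw [gaussianReal_of_var_ne_zero 0 one_ne_zero, gaussianPDF_def]
  rw [pi_withDensity_ofReal (fun _ => gaussianPDFReal 0 1) (fun _ => integrable_gaussianPDFReal 0 1)
    (fun _ => gaussianPDFReal_nonneg 0 1)]
  have hmp := PiLp.volume_preserving_toLp (Fin q)
  have he := (MeasurableEquiv.toLp 2 (Fin q → ℝ)).measurableEmbedding
  ext s hs
  rw [Measure.map_apply hmp.measurable hs, withDensity_apply _ (hmp.measurable hs),
    withDensity_apply _ hs, ← hmp.setLIntegral_comp_preimage_emb he]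
  refine lintegral_congr fun x => ?_
  congr 1
  simp only [gaussianPDFReal, gaussianDensity, Finset.prod_mul_distrib]
  rw [← Real.exp_sum]
  congr 1
  · have h : √((2 * Real.pi) ^ q) = √(2 * Real.pi) ^ q := by
      rw [Real.sqrt_eq_iff_mul_self_eq (by positivity) (by positivity), ← mul_pow,
        Real.mul_self_sqrt (by positivity)]
    rw [Matrix.det_one, mul_one, h, ← inv_pow]
    simp
  · simp [dotProduct, ← Finset.sum_div, pow_two]

open scoped MatrixOrder in
theorem multivariateGaussian_eq_withDensity {q : ℕ} (m : EuclideanSpace ℝ (Fin q))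
    (S : Matrix (Fin q) (Fin q) ℝ) (hS : S.PosDef) :
    multivariateGaussian m S = volume.withDensity fun v =>
      ENNReal.ofReal (gaussianDensity m S v) := by
  obtain ⟨A, hA, hAA, hAs⟩ : ∃ A, A = CFC.sqrt S ∧ A * A = S ∧ Aᵀ = A :=
    ⟨_, rfl, CFC.sqrt_mul_sqrt_self S hS.posSemidef.nonneg,
      (CFC.sqrt_nonneg S).posSemidef.isHermitian⟩
  have hdet : A.det * A.det = S.det := by rw [← det_mul, hAA]
  have hSd := hS.det_pos
  have hAd : A.det ≠ 0 := by intro h; rw [h] at hdet; simp at hdet; linarith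
  have hAS : A * S⁻¹ * A = 1 := by
    rw [← hAA, Matrix.mul_inv_rev, ← Matrix.mul_assoc,
      Matrix.mul_nonsing_inv _ (isUnit_iff_ne_zero.2 hAd), Matrix.one_mul,
      Matrix.nonsing_inv_mul _ (isUnit_iff_ne_zero.2 hAd)]
  rw [multivariateGaussian, ← hA, stdGaussian_eq_withDensity]
  set L : EuclideanSpace ℝ (Fin q) →ₗ[ℝ] EuclideanSpace ℝ (Fin q) :=
    (toEuclideanCLM (𝕜 := ℝ) A : _ →L[ℝ] _).toLinearMap with hL
  have hLd : LinearMap.det L = A.det := by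
    rw [hL, coe_toEuclideanCLM_eq_toEuclideanLin]
    exact LinearMap.det_toLpLin _ _
  set T : EuclideanSpace ℝ (Fin q) → EuclideanSpace ℝ (Fin q) :=
    fun x => m + toEuclideanCLM (𝕜 := ℝ) A x with hT
  have hTm : Measurable T := by fun_prop
  have hmap : (volume : Measure (EuclideanSpace ℝ (Fin q))) =
      ENNReal.ofReal |A.det| • (volume : Measure (EuclideanSpace ℝ (Fin q))).map T := by
    have h1 := Measure.map_linearMap_addHaar_eq_smul_addHaar
      (volume : Measure (EuclideanSpace ℝ (Fin q))) (f := L) (by rwa [hLd])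
    have h2 : T = (fun x => m + x) ∘ L := rfl
    rw [h2, ← Measure.map_map (by fun_prop) (by exact (toEuclideanCLM (𝕜 := ℝ) A).measurable), h1,
      Measure.map_smul, map_add_left_eq_self, smul_smul, hLd, ← ENNReal.ofReal_mul (abs_nonneg _),
      ← abs_mul, mul_inv_cancel₀ hAd]
    simp
  have hgm : Measurable (gaussianDensity m S) := by
    unfold gaussianDensity; fun_prop
  ext s hs
  rw [Measure.map_apply hTm hs, withDensity_apply _ (hTm hs), withDensity_apply _ hs]
  conv_rhs => rw [hmap]
  rw [Measure.restrict_smul, lintegral_smul_measure, setLIntegral_map hs (by fun_prop) hTm,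
    smul_eq_mul, ← lintegral_const_mul _ (by fun_prop)]
  refine lintegral_congr fun x => ?_
  rw [← ENNReal.ofReal_mul (abs_nonneg _)]
  congr 1
  simp only [gaussianDensity, hT, ← mul_assoc, add_sub_cancel_left, sub_zero]
  congr 1
  · rw [← hdet, Matrix.det_one, Real.sqrt_mul (by positivity), ← pow_two A.det,
      Real.sqrt_mul (by positivity), Real.sqrt_sq_eq_abs]
    have := abs_pos.2 hAd
    simp
    field_simp
  · congr 3
    rw [ofLp_toEuclideanCLM, Matrix.mulVec_mulVec, ← Matrix.vecMul_transpose A, hAs,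
      ← Matrix.dotProduct_mulVec, Matrix.mulVec_mulVec, ← Matrix.mul_assoc, hAS, inv_one]

theorem law_eq_withDensity {n p q : ℕ} (X : Matrix (Fin n) (Fin p) ℝ)
    (S : Matrix (Fin q) (Fin q) ℝ) (hS : S.PosDef) (B : Matrix (Fin p) (Fin q) ℝ) :
    law X S B = volume.withDensity fun y => ENNReal.ofReal (density X S B y) := by
  unfold law density
  have hi : ∀ i, Integrable (gaussianDensity (meanVector X B i) S) := fun i => by
    have h1 := multivariateGaussian_eq_withDensity (meanVector X B i) S hS
    have h2 : IsProbabilityMeasure (volume.withDensity fun v =>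
        ENNReal.ofReal (gaussianDensity (meanVector X B i) S v)) := h1 ▸ inferInstance
    refine ⟨by unfold gaussianDensity; fun_prop, ?_⟩
    have := h2.measure_univ
    rw [withDensity_apply _ .univ, setLIntegral_univ] at this
    rw [hasFiniteIntegral_iff_ofReal (Filter.Eventually.of_forall fun v => by
      unfold gaussianDensity; positivity), this]
    simp
  simp_rw [multivariateGaussian_eq_withDensity _ S hS]
  exact pi_withDensity_ofReal _ hi fun i v => by unfold gaussianDensity; positivity

/-- The maximum likelihood estimate `B̂ = (XᵀX)⁻¹ Xᵀ Y`. -/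
noncomputable def mle {n p q : ℕ} (X : Matrix (Fin n) (Fin p) ℝ) (y : Sample n q) :
    Matrix (Fin p) (Fin q) ℝ :=
  (Xᵀ * X)⁻¹ * Xᵀ * responseMatrix y

/-- The Kullback–Leibler discrepancy `d((B, S), (B̂, S))` from the true density to the plug-in
predictive density. -/
noncomputable def discrepancy {n p q : ℕ} (X : Matrix (Fin n) (Fin p) ℝ)
    (S : Matrix (Fin q) (Fin q) ℝ) (B : Matrix (Fin p) (Fin q) ℝ) (y : Sample n q) : ℝ :=
  LossEstimation.klDiscrepancy (density X S B) (density X S (mle X y))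

/-- `AIC = -2 log p(Y ∣ B̂, S) + 2 p q`. -/
noncomputable def AIC {n p q : ℕ} (X : Matrix (Fin n) (Fin p) ℝ)
    (S : Matrix (Fin q) (Fin q) ℝ) (y : Sample n q) : ℝ :=
  -2 * Real.log (density X S (mle X y) y) + 2 * (p * q : ℝ)

/-- `MAIC = AIC - (2 (p - 2q - 2) / q) tr(S ((X B̂)ᵀ (X B̂))⁻¹)`. -/
noncomputable def MAIC {n p q : ℕ} (X : Matrix (Fin n) (Fin p) ℝ)
    (S : Matrix (Fin q) (Fin q) ℝ) (y : Sample n q) : ℝ :=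
  AIC X S y - 2 * ((p : ℝ) - 2 * q - 2) / q *
    (S * ((X * mle X y)ᵀ * (X * mle X y))⁻¹).trace

end Regression

/-! Let `A = √S` and write the response as `X B + G A`, with `G` a standard normal `n × q` matrix.
With `P` the projection onto the column space of `X` and `H = 1 - 2P`, the error of AIC becomes `D =
tr(Gᵀ H G) - q tr H`, in which `B` no longer occurs (`AIC_sub_discrepancy`). The correction becomes
`c T`, where `c = 2(p - 2q - 2)/q`, `T = tr W⁻¹`, `W = Kᵀ K`, `K = P(M + G)` and `M = X B A⁻¹`
(`trace_mul_inv_noisySample`).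

Put `V = W⁻¹`. The gradient of `tr V` is `-2N` with `N = K V²`, and `H N = -N` because `H P = -P`.
Gaussian integration by parts for the field `(tr V) H G + 2N` then gives `E[D T] = 2 E[div N]`,
where `div N = (p - q - 2) tr V² - (tr V)²`. Cauchy–Schwarz, `(tr V)² ≤ q tr V²`, yields `2 div N ≥
c T²`. Hence `E[D T] ≥ c E[T²]`, and expanding the square gives `E[(D - c T)²] + E[(c T)²] ≤ E[D²]`,
which is strict for the first term.

Since `W` may be singular and `W⁻¹` is unbounded, the computation is carried out with `V = (W +
ε)⁻¹`, whose entries are at most `ε⁻¹` in absolute value; the additional terms have the favourable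
sign (`div_lower_bound`). This gives the inequality for each `ε > 0` (`integral_sq_sub_add_le`).
Fatou's lemma along `ε = 1/(k+1)` concludes in `lintegral_sq_sub_lt`, with no need for almost sure
invertibility of `W` or prior integrability of `T²`: where `W` is singular, the trace of the
resolvent blows up. -/

namespace GaussianMatrix

/-! ### Standard normal matrices and functions with finite moments -/

/-- The law of a random matrix whose entries are independent standard normal variables. -/
noncomputable def stdNormal (ι κ : Type*) [Fintype ι] [Fintype κ] : Measure (ι → κ → ℝ) :=
  Measure.pi fun _ => Measure.pi fun _ => gaussianReal 0 1

/-- All absolute moments of `f` are finite. -/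
def HasAllMoments {Ω : Type*} [MeasurableSpace Ω] (μ : Measure Ω) (f : Ω → ℝ) : Prop :=
  ∀ r : NNReal, MemLp f r μ

namespace HasAllMoments

variable {Ω : Type*} [MeasurableSpace Ω] {μ : Measure Ω} {f g : Ω → ℝ}

theorem add (hf : HasAllMoments μ f) (hg : HasAllMoments μ g) :
    HasAllMoments μ fun x => f x + g x := fun r => (hf r).add (hg r)

theorem sub (hf : HasAllMoments μ f) (hg : HasAllMoments μ g) :
    HasAllMoments μ fun x => f x - g x := fun r => (hf r).sub (hg r)

theorem neg (hf : HasAllMoments μ f) : HasAllMoments μ fun x => -f x := fun r => (hf r).neg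

theorem const_mul (hf : HasAllMoments μ f) (c : ℝ) : HasAllMoments μ fun x => c * f x :=
  fun r => (hf r).const_mul c

theorem mul (hf : HasAllMoments μ f) (hg : HasAllMoments μ g) :
    HasAllMoments μ fun x => f x * g x := fun r => by
  -- Hölder's inequality with `1/r = 1/(2r) + 1/(2r)`; this is why moments of every finite order are
  -- required.
  have h : ENNReal.HolderTriple ((2 * r : NNReal) : ℝ≥0∞) ((2 * r : NNReal) : ℝ≥0∞) r := by
    constructor
    rw [ENNReal.coe_mul, ENNReal.mul_inv (by simp) (by simp), ← add_mul]
    simp [ENNReal.inv_two_add_inv_two]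
  exact (hg (2 * r)).mul' (hf (2 * r))

theorem sum {τ : Type*} (s : Finset τ) {F : τ → Ω → ℝ} (hF : ∀ t, HasAllMoments μ (F t)) :
    HasAllMoments μ fun x => ∑ t ∈ s, F t x := fun r => memLp_finsetSum s fun t _ => hF t r

theorem const [IsFiniteMeasure μ] (c : ℝ) : HasAllMoments μ fun _ => c := fun _ => memLp_const c

theorem of_bounded [IsFiniteMeasure μ] (hf : Measurable f) (C : ℝ) (hC : ∀ x, |f x| ≤ C) :
    HasAllMoments μ f := fun _ =>
  MemLp.of_bound hf.aestronglyMeasurable C (Filter.Eventually.of_forall hC)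

theorem integrable (hf : HasAllMoments μ f) : Integrable f μ :=
  memLp_one_iff_integrable.1 (hf 1)

end HasAllMoments

section

variable {ι κ : Type*} [DecidableEq ι] [DecidableEq κ]

/-- The matrix unit at `(a, i)`. -/
def unit (a : ι) (i : κ) : ι → κ → ℝ := Pi.single a (Pi.single i 1)

theorem unit_apply (a b : ι) (i j : κ) :
    unit a i b j = if b = a then if j = i then (1 : ℝ) else 0 else 0 := by
  unfold unit
  by_cases h : b = a
  · subst h; simp [Pi.single_apply]
  · simp [h]

theorem hasLineDerivAt_entry (a b : ι) (i j : κ) (g : ι → κ → ℝ) :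
    HasLineDerivAt ℝ (fun g : ι → κ → ℝ => g b j) (unit a i b j) g (unit a i) := by
  unfold HasLineDerivAt
  simpa using ((hasDerivAt_id (0 : ℝ)).mul_const (unit a i b j)).const_add (g b j)

end

/-! ### Lebesgue density and Gaussian integration by parts -/

section

variable {ι κ : Type*} [Fintype ι] [Fintype κ]

instance : IsProbabilityMeasure (stdNormal ι κ) := by unfold stdNormal; infer_instance

theorem hasAllMoments_entry (a : ι) (i : κ) :
    HasAllMoments (stdNormal ι κ) fun g => g a i := fun r => by
  have h1 : MeasurePreserving (fun g : ι → κ → ℝ => g a i) (stdNormal ι κ) (gaussianReal 0 1) :=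
    (measurePreserving_eval (fun _ : κ => gaussianReal 0 1) i).comp
      (measurePreserving_eval (fun _ : ι => Measure.pi fun _ : κ => gaussianReal 0 1) a)
  exact (memLp_id_gaussianReal r).comp_measurePreserving h1

/-- The Lebesgue density of `stdNormal ι κ`. -/
noncomputable def stdDensity (g : ι → κ → ℝ) : ℝ :=
  ∏ a, ∏ i, gaussianPDFReal 0 1 (g a i)

theorem stdNormal_eq_withDensity :
    stdNormal ι κ = volume.withDensity fun g => ENNReal.ofReal (stdDensity g) := by
  unfold stdNormal stdDensity
  simp_rw [gaussianReal_of_var_ne_zero 0 one_ne_zero, gaussianPDF_def]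
  rw [Regression.pi_withDensity_ofReal (fun _ => gaussianPDFReal 0 1)
    (fun _ => integrable_gaussianPDFReal 0 1) (fun _ => gaussianPDFReal_nonneg 0 1)]
  exact Regression.pi_withDensity_ofReal (fun _ : ι => fun v : κ → ℝ => ∏ i, gaussianPDFReal 0 1 (v i))
    (fun _ => Integrable.fintype_prod_dep fun _ => integrable_gaussianPDFReal 0 1)
    (fun _ v => Finset.prod_nonneg fun _ _ => gaussianPDFReal_nonneg 0 1 _)

theorem stdDensity_nonneg (g : ι → κ → ℝ) : 0 ≤ stdDensity g :=
  Finset.prod_nonneg fun _ _ => Finset.prod_nonneg fun _ _ => gaussianPDFReal_nonneg 0 1 _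

theorem measurable_stdDensity : Measurable (stdDensity : (ι → κ → ℝ) → ℝ) := by
  unfold stdDensity
  have := measurable_gaussianPDFReal 0 1
  fun_prop

theorem stdDensity_eq (g : ι → κ → ℝ) :
    stdDensity g = (∏ _a : ι, ∏ _i : κ, (√(2 * Real.pi))⁻¹) *
      Real.exp (∑ a, ∑ i, -(g a i) ^ 2 / 2) := by
  simp only [stdDensity, gaussianPDFReal, Real.exp_sum, ← Finset.prod_mul_distrib]
  simp

theorem integrable_stdNormal_iff (f : (ι → κ → ℝ) → ℝ) :
    Integrable f (stdNormal ι κ) ↔ Integrable fun g => stdDensity g * f g := by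
  rw [stdNormal_eq_withDensity, integrable_withDensity_iff_integrable_smul'
    measurable_stdDensity.ennreal_ofReal (by simp)]
  simp only [ENNReal.toReal_ofReal (stdDensity_nonneg _), smul_eq_mul]

theorem integral_stdNormal (f : (ι → κ → ℝ) → ℝ) :
    ∫ g, f g ∂stdNormal ι κ = ∫ g, stdDensity g * f g := by
  rw [stdNormal_eq_withDensity, integral_withDensity_eq_integral_toReal_smul
    measurable_stdDensity.ennreal_ofReal (by simp)]
  simp only [ENNReal.toReal_ofReal (stdDensity_nonneg _), smul_eq_mul]

variable [DecidableEq ι] [DecidableEq κ]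

theorem hasLineDerivAt_stdDensity (a : ι) (i : κ) (g : ι → κ → ℝ) :
    HasLineDerivAt ℝ stdDensity (-(g a i * stdDensity g)) g (unit a i) := by
  have h : HasDerivAt (fun t : ℝ => ∑ b, ∑ j, -((g + t • unit a i) b j) ^ 2 / 2)
      (∑ b, ∑ j, -(g b j * unit a i b j)) 0 := by
    refine HasDerivAt.fun_sum fun b _ => HasDerivAt.fun_sum fun j _ => ?_
    have := (((hasLineDerivAt_entry a b i j g).fun_pow 2).fun_neg).div_const 2
    refine this.congr_deriv ?_
    simp
    ring
  have h2 := (h.exp).const_mul (∏ _a : ι, ∏ _i : κ, (√(2 * Real.pi))⁻¹)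
  unfold HasLineDerivAt
  simp_rw [stdDensity_eq]
  refine h2.congr_deriv ?_
  simp [unit_apply]
  ring

/-- Gaussian integration by parts. -/
theorem integral_entry_mul (a : ι) (i : κ) {F F' : (ι → κ → ℝ) → ℝ}
    (hF : HasAllMoments (stdNormal ι κ) F) (hF' : HasAllMoments (stdNormal ι κ) F')
    (hd : ∀ g, HasLineDerivAt ℝ F (F' g) g (unit a i)) :
    ∫ g, g a i * F g ∂stdNormal ι κ = ∫ g, F' g ∂stdNormal ι κ := by
  have h1 := (integrable_stdNormal_iff _).1 ((hasAllMoments_entry a i).mul hF).integrable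
  -- The derivative is moved onto the density, whose logarithmic derivative along the matrix unit is
  -- `-g a i`.
  have h := integral_bilinear_hasLineDerivAt_right_eq_neg_left_of_integrable
    (μ := (volume : Measure (ι → κ → ℝ))) (f := stdDensity) (f' := fun g => -(g a i * stdDensity g))
    (g := F) (g' := F') (v := unit a i) (B := ContinuousLinearMap.mul ℝ ℝ)
    (by simpa [mul_assoc, mul_comm, mul_left_comm] using h1.neg)
    (by simpa using (integrable_stdNormal_iff _).1 hF'.integrable)
    (by simpa using (integrable_stdNormal_iff _).1 hF.integrable)
    (fun x _ => hasLineDerivAt_stdDensity a i x) (fun x _ => hd x)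
  rw [integral_stdNormal, integral_stdNormal]
  simp only [ContinuousLinearMap.mul_apply', neg_mul, integral_neg, neg_neg] at h
  rw [h]
  congr 1 with g
  ring

end

/-! ### Entrywise derivatives of matrix-valued functions -/

/-- Entrywise differentiability of a matrix-valued function. -/
def HasMatDerivAt {ι κ : Type*} (F : ℝ → Matrix ι κ ℝ) (F' : Matrix ι κ ℝ) (t : ℝ) : Prop :=
  ∀ i j, HasDerivAt (fun s => F s i j) (F' i j) t

namespace HasMatDerivAt

variable {ι κ τ : Type*} {t : ℝ}

theorem const (A : Matrix ι κ ℝ) : HasMatDerivAt (fun _ => A) 0 t := fun i j =>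
  hasDerivAt_const t (A i j)

theorem add {F G : ℝ → Matrix ι κ ℝ} {F' G' : Matrix ι κ ℝ} (hF : HasMatDerivAt F F' t)
    (hG : HasMatDerivAt G G' t) : HasMatDerivAt (fun s => F s + G s) (F' + G') t :=
  fun i j => (hF i j).add (hG i j)

theorem transpose {F : ℝ → Matrix ι κ ℝ} {F' : Matrix ι κ ℝ} (hF : HasMatDerivAt F F' t) :
    HasMatDerivAt (fun s => (F s)ᵀ) F'ᵀ t := fun i j => hF j i

theorem mul [Fintype κ] {F : ℝ → Matrix ι κ ℝ} {F' : Matrix ι κ ℝ} {G : ℝ → Matrix κ τ ℝ}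
    {G' : Matrix κ τ ℝ} (hF : HasMatDerivAt F F' t) (hG : HasMatDerivAt G G' t) :
    HasMatDerivAt (fun s => F s * G s) (F' * G t + F t * G') t := fun i j => by
  simp only [Matrix.mul_apply, Matrix.add_apply, ← Finset.sum_add_distrib]
  exact HasDerivAt.fun_sum fun k _ => (hF i k).fun_mul (hG k j)

theorem const_mul [Fintype κ] (A : Matrix ι κ ℝ) {G : ℝ → Matrix κ τ ℝ}
    {G' : Matrix κ τ ℝ} (hG : HasMatDerivAt G G' t) :
    HasMatDerivAt (fun s => A * G s) (A * G') t := by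
  simpa using (const A).mul hG

theorem trace [Fintype ι] {F : ℝ → Matrix ι ι ℝ} {F' : Matrix ι ι ℝ}
    (hF : HasMatDerivAt F F' t) : HasDerivAt (fun s => (F s).trace) F'.trace t :=
  HasDerivAt.fun_sum fun i _ => hF i i

theorem inv [Fintype ι] [DecidableEq ι] {F : ℝ → Matrix ι ι ℝ} {F' : Matrix ι ι ℝ}
    (hF : HasMatDerivAt F F' t) (h : IsUnit (F t)) :
    HasMatDerivAt (fun s => (F s)⁻¹) (-((F t)⁻¹ * F' * (F t)⁻¹)) t := by
  -- The norm is only local: it makes the matrices a complete normed algebra, where inversion is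
  -- differentiable, and the conclusion is read off entrywise.
  let _ := Matrix.linftyOpNormedRing (n := ι) (α := ℝ)
  let _ := Matrix.linftyOpNormedAlgebra (n := ι) (R := ℝ) (α := ℝ)
  have h1 : HasDerivAt F F' t := hasDerivAt_pi.2 fun i => hasDerivAt_pi.2 fun j => hF i j
  obtain ⟨u, hu⟩ := h
  have h2 := hasFDerivAt_ringInverse (𝕜 := ℝ) u
  rw [hu] at h2
  have h3 := h2.comp_hasDerivAt t h1
  have h4 : ((u⁻¹ : (Matrix ι ι ℝ)ˣ) : Matrix ι ι ℝ) = (F t)⁻¹ := by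
    rw [Matrix.coe_units_inv, hu]
  intro i j
  have h5 := hasDerivAt_pi.1 (hasDerivAt_pi.1 h3 i) j
  simpa [Function.comp_def, ← Matrix.nonsing_inv_eq_ringInverse, h4] using h5

end HasMatDerivAt

/-! ### Sums over matrix units -/

section units

variable {ι κ : Type*} [Fintype ι] [Fintype κ] [DecidableEq ι] [DecidableEq κ]

theorem trace_unit_transpose_mul (a : ι) (i : κ) (N : Matrix ι κ ℝ) :
    ((Matrix.of (unit a i) : Matrix ι κ ℝ)ᵀ * N).trace = N a i := by
  simp [Matrix.trace, Matrix.mul_apply, unit_apply]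

/-- Contracting against a matrix unit splits into two traces here, while its transpose leaves a
single trace. These two rules compute every divergence below. -/
theorem sum_mul_unit_mul (A : Matrix ι ι ℝ) (B : Matrix κ κ ℝ) :
    ∑ a : ι, ∑ i : κ, (A * (Matrix.of (unit a i) : Matrix ι κ ℝ) * B) a i = A.trace * B.trace := by
  simp [Matrix.trace, Matrix.mul_apply, unit_apply, Finset.sum_mul_sum]

theorem sum_mul_unit_transpose_mul (A B : Matrix ι κ ℝ) :
    ∑ a : ι, ∑ i : κ, (A * (Matrix.of (unit a i) : Matrix ι κ ℝ)ᵀ * B) a i = (Aᵀ * B).trace := by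
  simp only [Matrix.trace, Matrix.diag, Matrix.mul_apply, unit_apply, transpose_apply, of_apply]
  rw [Finset.sum_comm]
  simp

end units

/-! ### The resolvent of a positive semidefinite matrix -/

section resolvent

variable {κ : Type*} {W : Matrix κ κ ℝ} {ε : ℝ}

theorem posDef_add_smul_one [DecidableEq κ] (hW : W.PosSemidef) (hε : 0 < ε) : (W + ε • 1).PosDef :=
  Matrix.PosDef.posSemidef_add hW (Matrix.PosDef.one.smul hε)

variable [Fintype κ]

/-- Cauchy–Schwarz on the diagonal entries; by symmetry `tr V²` is the sum of all squared entries,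
so the off-diagonal ones can be discarded. -/
theorem sq_trace_le (V : Matrix κ κ ℝ) (hV : Vᵀ = V) :
    V.trace ^ 2 ≤ Fintype.card κ * (V * V).trace := by
  have h1 : (∑ i, V i i) ^ 2 ≤ Fintype.card κ * ∑ i, V i i ^ 2 := by
    simpa using sq_sum_le_card_mul_sum_sq (s := Finset.univ) (f := fun i => V i i)
  refine h1.trans ?_
  gcongr
  simp only [Matrix.trace, Matrix.diag, Matrix.mul_apply]
  refine Finset.sum_le_sum fun i _ => ?_
  have h2 : ∀ j, V i j * V j i = V i j ^ 2 := fun j => by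
    rw [pow_two]; congr 1; exact congrFun (congrFun hV i) j
  simp_rw [h2]
  exact Finset.single_le_sum (f := fun j => V i j ^ 2) (fun j _ => sq_nonneg _) (Finset.mem_univ i)

variable [DecidableEq κ]

theorem posDef_resolvent (hW : W.PosSemidef) (hε : 0 < ε) : ((W + ε • 1)⁻¹).PosDef :=
  (posDef_add_smul_one hW hε).inv

theorem mul_resolvent (hW : W.PosSemidef) (hε : 0 < ε) :
    W * (W + ε • 1)⁻¹ = 1 - ε • (W + ε • 1)⁻¹ := by
  have := Matrix.mul_nonsing_inv (W + ε • 1) (posDef_add_smul_one hW hε).det_pos.ne'.isUnit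
  rw [Matrix.add_mul] at this
  rw [eq_sub_iff_add_eq]
  simpa using this

/-- Since `V W V = V - ε V²` is positive semidefinite, its diagonal gives `ε ∑ⱼ Vᵢⱼ² ≤ Vᵢᵢ`. The
term `j = i` bounds `Vᵢᵢ` by `ε⁻¹`, and the whole sum then bounds every entry of the row. -/
theorem abs_resolvent_apply_le (hW : W.PosSemidef) (hε : 0 < ε) (i j : κ) :
    |((W + ε • 1)⁻¹) i j| ≤ ε⁻¹ := by
  set V := (W + ε • 1)⁻¹ with hV
  have hVs : ∀ i j, V j i = V i j := fun i j => (posDef_resolvent hW hε).isHermitian.apply i j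
  have hVt : Vᵀ = V := by ext i j; exact hVs i j
  have h1 : (V * W * V).PosSemidef := by
    have := hW.conjTranspose_mul_mul_same V
    rwa [(posDef_resolvent hW hε).isHermitian.eq] at this
  have h2 : V * W * V = V - ε • (V * V) := by
    rw [Matrix.mul_assoc, mul_resolvent hW hε]
    simp [Matrix.mul_sub, ← hV]
  have h3 : ε * ∑ j, V i j ^ 2 ≤ V i i := by
    have := h1.diag_nonneg (i := i)
    rw [h2] at this
    simp only [Matrix.sub_apply, Matrix.smul_apply, Matrix.mul_apply, smul_eq_mul, hVs i] at this
    simp only [pow_two]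
    linarith
  have h4 : ∀ j, V i j ^ 2 ≤ ∑ j, V i j ^ 2 := fun j =>
    Finset.single_le_sum (f := fun j => V i j ^ 2) (fun j _ => sq_nonneg _) (Finset.mem_univ j)
  have h5 : 0 < V i i := (posDef_resolvent hW hε).diag_pos
  have h6 : V i i ≤ ε⁻¹ := by
    rw [← one_div, le_div_iff₀ hε]
    have : ε * V i i ^ 2 ≤ V i i := (mul_le_mul_of_nonneg_left (h4 i) hε.le).trans h3
    by_contra! hlt
    nlinarith
  refine abs_le_of_sq_le_sq ?_ (by positivity)
  refine (h4 j).trans ?_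
  have : ∑ j, V i j ^ 2 ≤ ε⁻¹ * V i i := by
    rw [← div_eq_inv_mul, le_div_iff₀ hε]; linarith
  refine this.trans ?_
  rw [pow_two]
  gcongr

/-- Substituting `W V = 1 - ε V` turns the bracket into `(p - q - 2) tr V² - (tr V)²` plus
nonnegative multiples of `ε`, with `q` the size of `W`. As `p ≥ q + 2`, the bound `(tr V)² ≤ q tr
V²` applies to the first term. -/
theorem div_lower_bound (hW : W.PosSemidef) (hε : 0 < ε) {V : Matrix κ κ ℝ}
    (hV : V = (W + ε • 1)⁻¹) {p : ℝ} (hp : (Fintype.card κ : ℝ) + 2 ≤ p) :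
    (p - 2 * Fintype.card κ - 2) * V.trace ^ 2 ≤ Fintype.card κ *
      (p * (V * V).trace - 2 * (W * V * V * V).trace - (W * V * V).trace * V.trace
        - (W * V).trace * (V * V).trace) := by
  have hPD : V.PosDef := hV ▸ posDef_resolvent hW hε
  have hVt : Vᵀ = V := hPD.isHermitian
  have h0 : W * V = 1 - ε • V := by rw [hV]; exact mul_resolvent hW hε
  have h1 : 0 ≤ V.trace := hPD.posSemidef.trace_nonneg
  have h2 : 0 ≤ (V * V).trace := by
    have := (Matrix.posSemidef_conjTranspose_mul_self V).trace_nonneg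
    rwa [hPD.isHermitian.eq] at this
  have h3 : 0 ≤ (V * V * V).trace := by
    have := (hPD.posSemidef.conjTranspose_mul_mul_same V).trace_nonneg
    rwa [hPD.isHermitian.eq] at this
  have h4 := sq_trace_le V hVt
  simp only [h0, Matrix.sub_mul, Matrix.one_mul, Matrix.smul_mul, Matrix.trace_sub,
    Matrix.trace_smul, Matrix.trace_one, smul_eq_mul]
  have hq : (0 : ℝ) ≤ Fintype.card κ := by positivity
  have h5 := mul_le_mul_of_nonneg_left h4 (show 0 ≤ p - Fintype.card κ - 2 by linarith)
  -- The total contribution of `ε`, which is dropped.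
  have h6 : 0 ≤ Fintype.card κ * (2 * (ε * (V * V * V).trace) + ε * (V * V).trace * V.trace
    + ε * V.trace * (V * V).trace) := by positivity
  linarith

end resolvent

/-- Every entry of the random matrix `F` has all moments. -/
def HasMatMoments {Ω ι κ : Type*} [MeasurableSpace Ω] (μ : Measure Ω) (F : Ω → Matrix ι κ ℝ) :
    Prop :=
  ∀ i j, HasAllMoments μ fun x => F x i j

namespace HasMatMoments

variable {Ω ι κ τ : Type*} [MeasurableSpace Ω] {μ : Measure Ω}

theorem const [IsFiniteMeasure μ] (A : Matrix ι κ ℝ) : HasMatMoments μ fun _ => A :=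
  fun i j => .const (A i j)

theorem add {F G : Ω → Matrix ι κ ℝ} (hF : HasMatMoments μ F) (hG : HasMatMoments μ G) :
    HasMatMoments μ fun x => F x + G x := fun i j => (hF i j).add (hG i j)

theorem neg {F : Ω → Matrix ι κ ℝ} (hF : HasMatMoments μ F) :
    HasMatMoments μ fun x => -F x := fun i j => (hF i j).neg

theorem transpose {F : Ω → Matrix ι κ ℝ} (hF : HasMatMoments μ F) :
    HasMatMoments μ fun x => (F x)ᵀ := fun i j => hF j i

theorem mul [Fintype κ] {F : Ω → Matrix ι κ ℝ} {G : Ω → Matrix κ τ ℝ}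
    (hF : HasMatMoments μ F) (hG : HasMatMoments μ G) : HasMatMoments μ fun x => F x * G x :=
  fun i j => by
    simp only [Matrix.mul_apply]
    exact .sum _ fun k => (hF i k).mul (hG k j)

theorem trace [Fintype ι] {F : Ω → Matrix ι ι ℝ} (hF : HasMatMoments μ F) :
    HasAllMoments μ fun x => (F x).trace := .sum _ fun i => hF i i

end HasMatMoments

/-- The adjugate times the inverse of the determinant is measurable everywhere, including at
singular matrices, where the inverse is zero by convention. -/
theorem measurable_inv_apply {Ω κ : Type*} [Fintype κ] [DecidableEq κ] [TopologicalSpace Ω]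
    [MeasurableSpace Ω] [OpensMeasurableSpace Ω] {F : Ω → Matrix κ κ ℝ} (hF : Continuous F)
    (i j : κ) : Measurable fun x => (F x)⁻¹ i j := by
  simp only [Matrix.inv_def, Matrix.smul_apply, Ring.inverse_eq_inv', smul_eq_mul]
  exact hF.matrix_det.measurable.inv.mul
    ((hF.matrix_adjugate.matrix_elem i j).measurable)

/-! ### The Gram matrix of a projected Gaussian matrix, its resolvent, and the quadratic form -/

section

variable {ι κ : Type*} [Fintype ι]

/-- The Gram matrix `(M + G)ᵀ P (M + G)`. -/
def gram (P : Matrix ι ι ℝ) (M : Matrix ι κ ℝ) (g : ι → κ → ℝ) : Matrix κ κ ℝ :=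
  (M + Matrix.of g)ᵀ * P * (M + Matrix.of g)

theorem continuous_gram (P : Matrix ι ι ℝ) (M : Matrix ι κ ℝ) : Continuous (gram P M) := by
  unfold gram
  have : Continuous fun g : ι → κ → ℝ => M + Matrix.of g :=
    continuous_const.add continuous_id
  exact (this.matrix_transpose.matrix_mul continuous_const).matrix_mul this

theorem gram_eq {P : Matrix ι ι ℝ} (hPt : Pᵀ = P) (hPP : P * P = P) (M : Matrix ι κ ℝ)
    (g : ι → κ → ℝ) :
    gram P M g = (P * (M + Matrix.of g))ᵀ * (P * (M + Matrix.of g)) := by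
  rw [gram, transpose_mul, hPt, ← Matrix.mul_assoc, Matrix.mul_assoc _ P P, hPP]

variable [Fintype κ]

theorem posSemidef_gram {P : Matrix ι ι ℝ} (hPt : Pᵀ = P) (hPP : P * P = P) (M : Matrix ι κ ℝ)
    (g : ι → κ → ℝ) : (gram P M g).PosSemidef := by
  rw [gram_eq hPt hPP]
  simpa using Matrix.posSemidef_conjTranspose_mul_self (P * (M + Matrix.of g))

/-- The quadratic form `tr (Gᵀ H G)`, centred at its mean. -/
def centredForm (H : Matrix ι ι ℝ) (g : ι → κ → ℝ) : ℝ :=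
  ((Matrix.of g)ᵀ * (H * Matrix.of g)).trace - Fintype.card κ * H.trace

theorem hasMatMoments_of : HasMatMoments (stdNormal ι κ) fun g => Matrix.of g :=
  fun a i => hasAllMoments_entry a i

theorem hasAllMoments_centredForm (H : Matrix ι ι ℝ) :
    HasAllMoments (stdNormal ι κ) (centredForm H) :=
  (hasMatMoments_of.transpose.mul ((HasMatMoments.const H).mul hasMatMoments_of)).trace.sub
    (.const _)

theorem continuous_centredForm (H : Matrix ι ι ℝ) :
    Continuous (centredForm H : (ι → κ → ℝ) → ℝ) := by
  have h : Continuous fun g : ι → κ → ℝ => Matrix.of g := continuous_id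
  exact ((h.matrix_transpose.matrix_mul (continuous_const.matrix_mul h)).matrix_trace).sub
    continuous_const

variable [DecidableEq κ]

/-- The resolvent `((M + G)ᵀ P (M + G) + ε)⁻¹` of the Gram matrix. -/
noncomputable def resolvent (P : Matrix ι ι ℝ) (M : Matrix ι κ ℝ) (ε : ℝ) (g : ι → κ → ℝ) :
    Matrix κ κ ℝ :=
  (gram P M g + ε • 1)⁻¹

theorem measurable_resolvent_apply (P : Matrix ι ι ℝ) (M : Matrix ι κ ℝ) (ε : ℝ) (i j : κ) :
    Measurable fun g => resolvent P M ε g i j :=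
  measurable_inv_apply ((continuous_gram P M).add continuous_const) i j

theorem resolvent_transpose {P : Matrix ι ι ℝ} (hPt : Pᵀ = P) (hPP : P * P = P)
    (M : Matrix ι κ ℝ) {ε : ℝ} (hε : 0 < ε) (g : ι → κ → ℝ) :
    (resolvent P M ε g)ᵀ = resolvent P M ε g :=
  (posDef_resolvent (posSemidef_gram hPt hPP M g) hε).isHermitian

theorem hasMatMoments_resolvent {P : Matrix ι ι ℝ} (hPt : Pᵀ = P) (hPP : P * P = P)
    (M : Matrix ι κ ℝ) {ε : ℝ} (hε : 0 < ε) :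
    HasMatMoments (stdNormal ι κ) (resolvent P M ε) := fun i j =>
  .of_bounded (measurable_resolvent_apply P M ε i j) ε⁻¹ fun g =>
    abs_resolvent_apply_le (posSemidef_gram hPt hPP M g) hε i j

end

/-! ### Derivatives of the resolvent and the divergence identity -/

section

variable {ι κ : Type*}

theorem trace_transpose_mul_eq_sum [Fintype ι] [Fintype κ] (A B : Matrix ι κ ℝ) :
    (Aᵀ * B).trace = ∑ a, ∑ i, A a i * B a i := by
  simp only [Matrix.trace, Matrix.diag, Matrix.mul_apply, transpose_apply]
  exact Finset.sum_comm

variable [DecidableEq ι] [DecidableEq κ]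

theorem hasMatDerivAt_of (g : ι → κ → ℝ) (a : ι) (i : κ) :
    HasMatDerivAt (fun t : ℝ => (Matrix.of (g + t • unit a i) : Matrix ι κ ℝ))
      (Matrix.of (unit a i)) 0 :=
  fun b j => hasLineDerivAt_entry a b i j g

theorem hasMatDerivAt_const_add_of (M : Matrix ι κ ℝ) (g : ι → κ → ℝ) (a : ι) (i : κ) :
    HasMatDerivAt (fun t : ℝ => M + Matrix.of (g + t • unit a i)) (Matrix.of (unit a i)) 0 := by
  simpa using (HasMatDerivAt.const M).add (hasMatDerivAt_of g a i)

variable [Fintype ι] [Fintype κ]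

/-- The directional derivative at `g`, along the matrix unit at `(a, i)`, of the resolvent. -/
noncomputable def resolventDeriv (P : Matrix ι ι ℝ) (M : Matrix ι κ ℝ) (ε : ℝ) (g : ι → κ → ℝ)
    (a : ι) (i : κ) : Matrix κ κ ℝ :=
  -(resolvent P M ε g *
    ((Matrix.of (unit a i) : Matrix ι κ ℝ)ᵀ * (P * (M + Matrix.of g))
      + (P * (M + Matrix.of g))ᵀ * Matrix.of (unit a i)) * resolvent P M ε g)

theorem hasMatDerivAt_resolvent {P : Matrix ι ι ℝ} (hPt : Pᵀ = P) (hPP : P * P = P)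
    (M : Matrix ι κ ℝ) {ε : ℝ} (hε : 0 < ε) (g : ι → κ → ℝ) (a : ι) (i : κ) :
    HasMatDerivAt (fun t : ℝ => resolvent P M ε (g + t • unit a i))
      (resolventDeriv P M ε g a i) 0 := by
  have hZ := hasMatDerivAt_const_add_of M g a i
  have hW := ((hZ.transpose.mul (.const P)).mul hZ).add (.const (ε • (1 : Matrix κ κ ℝ)))
  have h := hW.inv (posDef_add_smul_one (posSemidef_gram hPt hPP M _) hε).isUnit
  simpa [resolventDeriv, resolvent, gram, hPt, Matrix.transpose_mul, Matrix.mul_assoc] using h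

/-- Differentiating `K V²`, the factor `K` contributes the first term and each `V` contributes two,
as `W = Kᵀ K` has two factors. The two terms with a transposed unit coincide after contraction,
whence the coefficient `2`. -/
theorem sum_divergence (P : Matrix ι ι ℝ) (K : Matrix ι κ ℝ) {V : Matrix κ κ ℝ} (hV : Vᵀ = V) :
    ∑ a : ι, ∑ i : κ, (P * (Matrix.of (unit a i) : Matrix ι κ ℝ) * (V * V)
      - (K * V * (Matrix.of (unit a i) : Matrix ι κ ℝ)ᵀ * (K * V * V)
        + K * V * Kᵀ * (Matrix.of (unit a i) : Matrix ι κ ℝ) * (V * V)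
        + K * V * V * (Matrix.of (unit a i) : Matrix ι κ ℝ)ᵀ * (K * V)
        + K * V * V * Kᵀ * (Matrix.of (unit a i) : Matrix ι κ ℝ) * V)) a i =
      P.trace * (V * V).trace - 2 * (Kᵀ * K * V * V * V).trace
        - (Kᵀ * K * V * V).trace * V.trace - (Kᵀ * K * V).trace * (V * V).trace := by
  have h1 : ((K * V)ᵀ * (K * V * V)).trace = (Kᵀ * K * V * V * V).trace := by
    rw [transpose_mul, hV, Matrix.mul_assoc V, Matrix.trace_mul_comm]
    simp only [Matrix.mul_assoc]
  have h2 : ((K * V * V)ᵀ * (K * V)).trace = (Kᵀ * K * V * V * V).trace := by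
    rw [← Matrix.trace_transpose, transpose_mul, transpose_transpose, h1]
  have h3 : (K * V * Kᵀ).trace = (Kᵀ * K * V).trace := by
    rw [Matrix.trace_mul_comm, Matrix.mul_assoc]
  have h4 : (K * V * V * Kᵀ).trace = (Kᵀ * K * V * V).trace := by
    rw [Matrix.trace_mul_comm]; simp only [Matrix.mul_assoc]
  simp only [Matrix.sub_apply, Matrix.add_apply, Finset.sum_sub_distrib, Finset.sum_add_distrib,
    sum_mul_unit_mul, sum_mul_unit_transpose_mul, h1, h2, h3, h4]
  ring

/-- The directional derivative at `g`, along the matrix unit at `(a, i)`, of the matrix field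
`P (M + G) V²`, for `V` the resolvent. -/
noncomputable def fieldDeriv (P : Matrix ι ι ℝ) (M : Matrix ι κ ℝ) (ε : ℝ) (g : ι → κ → ℝ)
    (a : ι) (i : κ) : Matrix ι κ ℝ :=
  (P * Matrix.of (unit a i) * resolvent P M ε g
      + P * (M + Matrix.of g) * resolventDeriv P M ε g a i) * resolvent P M ε g
    + P * (M + Matrix.of g) * resolvent P M ε g * resolventDeriv P M ε g a i

theorem sum_fieldDeriv {P : Matrix ι ι ℝ} (hPt : Pᵀ = P) (hPP : P * P = P)
    (M : Matrix ι κ ℝ) {ε : ℝ} (hε : 0 < ε) (g : ι → κ → ℝ)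
    {V W : Matrix κ κ ℝ} (hV : V = resolvent P M ε g) (hW : W = gram P M g) :
    ∑ a, ∑ i, fieldDeriv P M ε g a i a i =
      P.trace * (V * V).trace - 2 * (W * V * V * V).trace
        - (W * V * V).trace * V.trace - (W * V).trace * (V * V).trace := by
  have hVt : Vᵀ = V := by rw [hV]; exact resolvent_transpose hPt hPP M hε g
  rw [hW, gram_eq hPt hPP, ← sum_divergence P (P * (M + Matrix.of g)) hVt]
  refine Finset.sum_congr rfl fun a _ => Finset.sum_congr rfl fun i _ => ?_
  refine congrFun (congrFun ?_ a) i
  simp only [fieldDeriv, resolventDeriv, ← hV]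
  generalize P * (M + Matrix.of g) = K
  simp only [Matrix.mul_neg, Matrix.mul_add, Matrix.add_mul, Matrix.neg_mul, Matrix.mul_assoc]
  abel

theorem hasMatDerivAt_field {P : Matrix ι ι ℝ} (hPt : Pᵀ = P) (hPP : P * P = P)
    (M : Matrix ι κ ℝ) {ε : ℝ} (hε : 0 < ε) (g : ι → κ → ℝ) (a : ι) (i : κ) :
    HasMatDerivAt (fun t : ℝ => P * (M + Matrix.of (g + t • unit a i))
        * resolvent P M ε (g + t • unit a i) * resolvent P M ε (g + t • unit a i))
      (fieldDeriv P M ε g a i) 0 := by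
  have hR := hasMatDerivAt_resolvent hPt hPP M hε g a i
  have h := (((hasMatDerivAt_const_add_of M g a i).const_mul P).mul hR).mul hR
  simpa [fieldDeriv] using h

/-- The gradient of the trace of the resolvent is `-2 K V²`, the same field whose divergence is
computed above. This coincidence makes the cross terms in `integral_centredForm_mul_trace` cancel.
-/
theorem trace_resolventDeriv {P : Matrix ι ι ℝ} (hPt : Pᵀ = P) (hPP : P * P = P)
    (M : Matrix ι κ ℝ) {ε : ℝ} (hε : 0 < ε) (g : ι → κ → ℝ) (a : ι) (i : κ) :
    (resolventDeriv P M ε g a i).trace =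
      -2 * (P * (M + Matrix.of g) * resolvent P M ε g * resolvent P M ε g) a i := by
  have hVt := resolvent_transpose hPt hPP M hε g
  unfold resolventDeriv
  set V := resolvent P M ε g
  set K := P * (M + Matrix.of g)
  have h1 : (V * ((Matrix.of (unit a i) : Matrix ι κ ℝ)ᵀ * K) * V).trace = (K * V * V) a i := by
    rw [Matrix.trace_mul_comm, ← Matrix.mul_assoc, Matrix.trace_mul_comm,
      ← trace_unit_transpose_mul a i (K * V * V)]
    simp only [Matrix.mul_assoc]
  have h2 : (V * (Kᵀ * (Matrix.of (unit a i) : Matrix ι κ ℝ)) * V).trace = (K * V * V) a i := by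
    rw [← h1, ← Matrix.trace_transpose]
    simp only [transpose_mul, transpose_transpose, hVt, Matrix.mul_assoc]
  rw [Matrix.trace_neg, Matrix.mul_add, Matrix.add_mul, Matrix.trace_add, h1, h2]
  ring

theorem hasMatMoments_resolventDeriv {P : Matrix ι ι ℝ} (hPt : Pᵀ = P) (hPP : P * P = P)
    (M : Matrix ι κ ℝ) {ε : ℝ} (hε : 0 < ε) (a : ι) (i : κ) :
    HasMatMoments (stdNormal ι κ) fun g => resolventDeriv P M ε g a i := by
  have hV := hasMatMoments_resolvent hPt hPP M hε
  have hK : HasMatMoments (stdNormal ι κ) fun g => P * (M + Matrix.of g) :=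
    (HasMatMoments.const P).mul ((HasMatMoments.const M).add hasMatMoments_of)
  have hE := HasMatMoments.const (μ := stdNormal ι κ) (Matrix.of (unit a i) : Matrix ι κ ℝ)
  exact ((hV.mul ((hE.transpose.mul hK).add (hK.transpose.mul hE))).mul hV).neg

theorem hasMatMoments_fieldDeriv {P : Matrix ι ι ℝ} (hPt : Pᵀ = P) (hPP : P * P = P)
    (M : Matrix ι κ ℝ) {ε : ℝ} (hε : 0 < ε) (a : ι) (i : κ) :
    HasMatMoments (stdNormal ι κ) fun g => fieldDeriv P M ε g a i := by
  have hV := hasMatMoments_resolvent hPt hPP M hε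
  have hV' := hasMatMoments_resolventDeriv hPt hPP M hε a i
  have hK : HasMatMoments (stdNormal ι κ) fun g => P * (M + Matrix.of g) :=
    (HasMatMoments.const P).mul ((HasMatMoments.const M).add hasMatMoments_of)
  exact ((((HasMatMoments.const (P * Matrix.of (unit a i))).mul hV).add (hK.mul hV')).mul hV).add
    ((hK.mul hV).mul hV')

/-- The integration by parts behind unbiased estimation of a centred quadratic form. -/
theorem integral_centredForm_mul_trace {P H : Matrix ι ι ℝ} (hPt : Pᵀ = P) (hPP : P * P = P)
    (hHt : Hᵀ = H) (hHP : H * P = -P) (M : Matrix ι κ ℝ) {ε : ℝ} (hε : 0 < ε) :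
    ∫ g, centredForm H g * (resolvent P M ε g).trace ∂stdNormal ι κ =
      ∫ g, 2 * ∑ a, ∑ i, fieldDeriv P M ε g a i a i ∂stdNormal ι κ := by
  set N : (ι → κ → ℝ) → Matrix ι κ ℝ := fun g =>
    P * (M + Matrix.of g) * resolvent P M ε g * resolvent P M ε g with hN
  -- Differentiating the trace in the first summand produces `-2⟨H G, N⟩ = 2⟨G, N⟩`. The summand `2
  -- N` is added so that its pairing with `G` is the same quantity and the two cancel, leaving only
  -- `2 div N`.
  set F : ι → κ → (ι → κ → ℝ) → ℝ := fun a i g =>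
    (H * Matrix.of g) a i * (resolvent P M ε g).trace + 2 * N g a i with hF
  set F' : ι → κ → (ι → κ → ℝ) → ℝ := fun a i g =>
    (H * Matrix.of (unit a i)) a i * (resolvent P M ε g).trace
      + (H * Matrix.of g) a i * (resolventDeriv P M ε g a i).trace
      + 2 * fieldDeriv P M ε g a i a i with hF'
  have hV := hasMatMoments_resolvent hPt hPP M hε
  have hV' := hasMatMoments_resolventDeriv hPt hPP M hε
  have hK : HasMatMoments (stdNormal ι κ) fun g => P * (M + Matrix.of g) :=
    (HasMatMoments.const P).mul ((HasMatMoments.const M).add hasMatMoments_of)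
  have hHG : HasMatMoments (stdNormal ι κ) fun g => H * Matrix.of g :=
    (HasMatMoments.const H).mul hasMatMoments_of
  have hN1 : HasMatMoments (stdNormal ι κ) N := (hK.mul hV).mul hV
  have hfd := fun a i => hasMatMoments_fieldDeriv hPt hPP M hε a i
  have hF1 : ∀ a i, HasAllMoments (stdNormal ι κ) (F a i) := fun a i =>
    ((hHG a i).mul hV.trace).add ((hN1 a i).const_mul 2)
  have hF2 : ∀ a i, HasAllMoments (stdNormal ι κ) (F' a i) := fun a i =>
    ((hV.trace.const_mul _).add ((hHG a i).mul (hV' a i).trace)).add ((hfd a i a i).const_mul 2)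
  have hd : ∀ a i g, HasLineDerivAt ℝ (F a i) (F' a i g) g (unit a i) := fun a i g => by
    have h1 := ((hasMatDerivAt_of g a i).const_mul H a i).fun_mul
      (hasMatDerivAt_resolvent hPt hPP M hε g a i).trace
    have h2 := (hasMatDerivAt_field hPt hPP M hε g a i a i).const_mul 2
    simpa [HasLineDerivAt] using h1.fun_add h2
  have hS : ∫ g, ∑ a, ∑ i, (g a i * F a i g - F' a i g) ∂stdNormal ι κ = 0 := by
    have hi : ∀ a i, Integrable (fun g => g a i * F a i g - F' a i g) (stdNormal ι κ) :=
      fun a i => (((hasAllMoments_entry a i).mul (hF1 a i)).sub (hF2 a i)).integrable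
    rw [integral_finsetSum _ fun a _ => integrable_finsetSum _ fun i _ => hi a i]
    refine Finset.sum_eq_zero fun a _ => ?_
    rw [integral_finsetSum _ fun i _ => hi a i]
    refine Finset.sum_eq_zero fun i _ => ?_
    rw [integral_sub ((hasAllMoments_entry a i).mul (hF1 a i)).integrable (hF2 a i).integrable,
      integral_entry_mul a i (hF1 a i) (hF2 a i) (hd a i), sub_self]
  have hp : ∀ g, ∑ a, ∑ i, (g a i * F a i g - F' a i g) =
      centredForm H g * (resolvent P M ε g).trace - 2 * ∑ a, ∑ i, fieldDeriv P M ε g a i a i := by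
    intro g
    have e1 : ∑ a, ∑ i, (g a i * F a i g - F' a i g) =
        (∑ a, ∑ i, (Matrix.of g) a i * (H * Matrix.of g) a i) * (resolvent P M ε g).trace
        + 2 * (∑ a, ∑ i, (Matrix.of g) a i * N g a i)
        - (∑ a : ι, ∑ i : κ, (H * (Matrix.of (unit a i) : Matrix ι κ ℝ) * (1 : Matrix κ κ ℝ)) a i)
          * (resolvent P M ε g).trace
        + 2 * (∑ a, ∑ i, (H * Matrix.of g) a i * N g a i)
        - 2 * ∑ a, ∑ i, fieldDeriv P M ε g a i a i := by
      simp only [Finset.sum_mul, Finset.mul_sum, ← Finset.sum_add_distrib,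
        ← Finset.sum_sub_distrib]
      refine Finset.sum_congr rfl fun a _ => Finset.sum_congr rfl fun i _ => ?_
      simp only [hF, hF', trace_resolventDeriv hPt hPP M hε, Matrix.mul_one, of_apply]
      ring
    -- The columns of `N` lie in the range of `P`, on which `H` acts as `-1`.
    have e2 : ((H * Matrix.of g)ᵀ * N g).trace = -((Matrix.of g)ᵀ * N g).trace := by
      have : H * N g = -N g := by
        simp only [hN, ← Matrix.mul_assoc, hHP, Matrix.neg_mul]
      rw [transpose_mul, hHt, Matrix.mul_assoc, this, Matrix.mul_neg, Matrix.trace_neg]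
    rw [e1, ← trace_transpose_mul_eq_sum, ← trace_transpose_mul_eq_sum,
      ← trace_transpose_mul_eq_sum, e2, sum_mul_unit_mul, Matrix.trace_one, centredForm]
    ring
  simp_rw [hp] at hS
  rw [integral_sub ((hasAllMoments_centredForm H).mul hV.trace).integrable
    ((HasAllMoments.sum _ fun a => HasAllMoments.sum _ fun i => hfd a i a i).const_mul
      2).integrable] at hS
  linarith

end

/-! ### The resolvent as `ε` tends to zero -/

section singular

variable {κ : Type*} [Fintype κ] [DecidableEq κ] {W : Matrix κ κ ℝ} {ε : ℝ}

/-- A kernel vector `v` of `W` is an eigenvector of `V` with eigenvalue `ε⁻¹`. With `Q = v vᵀ` and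
`N = |v|²`, the matrix `N - Q` is `N` times the projection onto the complement of `v`; nonnegativity
of the trace of `(N - Q) V (N - Q)` says that the rest of the spectrum contributes at least zero. -/
theorem inv_le_trace_resolvent_of_det_eq_zero (hW : W.PosSemidef) (hdet : W.det = 0)
    (hε : 0 < ε) : ε⁻¹ ≤ ((W + ε • 1)⁻¹).trace := by
  obtain ⟨v, hv0, hv⟩ := Matrix.exists_mulVec_eq_zero_iff.2 hdet
  set V := (W + ε • 1)⁻¹ with hV
  have hVv : V *ᵥ v = ε⁻¹ • v := by
    have h1 : (W + ε • 1) *ᵥ v = ε • v := by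
      rw [Matrix.add_mulVec, hv, zero_add, Matrix.smul_mulVec, Matrix.one_mulVec]
    have h2 : V *ᵥ ((W + ε • 1) *ᵥ v) = v := by
      rw [Matrix.mulVec_mulVec, hV,
        Matrix.nonsing_inv_mul _ (posDef_add_smul_one hW hε).det_pos.ne'.isUnit, Matrix.one_mulVec]
    rw [h1, Matrix.mulVec_smul] at h2
    rw [eq_inv_smul_iff₀ hε.ne', h2]
  set N : ℝ := v ⬝ᵥ v with hN
  have hNpos : 0 < N :=
    lt_of_le_of_ne (by simpa using dotProduct_star_self_nonneg v)
      fun h => hv0 (dotProduct_self_eq_zero.1 h.symm)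
  set Q := vecMulVec v v with hQ
  have hQt : Qᵀ = Q := by rw [hQ, transpose_vecMulVec]
  have hVQ : V * Q = ε⁻¹ • Q := by rw [hQ, mul_vecMulVec, hVv, smul_vecMulVec]
  have hQQ : Q * Q = N • Q := by
    rw [hQ, vecMulVec_mul_vecMulVec, vecMulVec_smul]
  have hQtr : Q.trace = N := by rw [hQ, trace_vecMulVec]
  have h3 := ((posDef_resolvent hW hε).posSemidef.conjTranspose_mul_mul_same
    (N • 1 - Q)).trace_nonneg
  have h4 : (N • (1 : Matrix κ κ ℝ) - Q)ᴴ = N • 1 - Q := by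
    simp [conjTranspose_eq_transpose_of_trivial, hQt]
  rw [h4, ← hV, Matrix.trace_mul_comm, ← Matrix.mul_assoc, Matrix.trace_mul_comm] at h3
  have h5 : V * ((N • 1 - Q) * (N • 1 - Q)) = (N * N) • V - (N * ε⁻¹) • Q := by
    have : (N • (1 : Matrix κ κ ℝ) - Q) * (N • 1 - Q) = (N * N) • 1 - N • Q := by
      simp only [Matrix.sub_mul, Matrix.mul_sub, hQQ, Matrix.smul_mul, Matrix.mul_smul,
        Matrix.one_mul, Matrix.mul_one, smul_smul, smul_sub]
      abel
    rw [this, Matrix.mul_sub, Matrix.mul_smul, Matrix.mul_smul, hVQ, Matrix.mul_one, smul_smul]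
  rw [h5, Matrix.trace_sub, Matrix.trace_smul, Matrix.trace_smul, hQtr, smul_eq_mul,
    smul_eq_mul] at h3
  have h6 : (N * N) * ε⁻¹ ≤ (N * N) * V.trace := by linarith
  exact le_of_mul_le_mul_left h6 (by positivity)

/-- Inversion is differentiable, hence continuous, along the line `W + s` at `s = 0`. -/
theorem tendsto_trace_resolvent (hW : IsUnit W) :
    Filter.Tendsto (fun k : ℕ => ((W + (1 / ((k : ℝ) + 1)) • 1)⁻¹).trace) Filter.atTop
      (nhds (W⁻¹).trace) := by
  have h1 : HasMatDerivAt (fun s : ℝ => W + s • (1 : Matrix κ κ ℝ)) 1 0 := fun i j => by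
    simpa using ((hasDerivAt_id (0 : ℝ)).mul_const ((1 : Matrix κ κ ℝ) i j)).const_add (W i j)
  have h2 := (h1.inv (by simpa using hW)).trace.continuousAt.tendsto
  simp only [zero_smul, add_zero] at h2
  exact h2.comp tendsto_one_div_add_atTop_nhds_zero_nat

end singular

/-! ### The risk inequality, first regularised and then in the limit -/

section

variable {ι κ : Type*} [Fintype ι] [Fintype κ] [DecidableEq ι] [DecidableEq κ]

/-- With `f` the trace of the resolvent, the left integrand is `D² - 2c (D f - c f²)`, so the claim
reduces to `c E[f²] ≤ E[D f]`. That follows pointwise from the divergence bound after integration by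
parts. The extra square kept on the left is what later gives strictness. -/
theorem integral_sq_sub_add_le {P : Matrix ι ι ℝ} (hPt : Pᵀ = P) (hPP : P * P = P)
    (M : Matrix ι κ ℝ) (hκ : 0 < Fintype.card κ) {c : ℝ}
    (hc : c = 2 * (P.trace - 2 * Fintype.card κ - 2) / Fintype.card κ) (hc0 : 0 < c)
    {ε : ℝ} (hε : 0 < ε) :
    ∫ g, ((centredForm (1 - (2 : ℝ) • P) g - c * (resolvent P M ε g).trace) ^ 2
        + (c * (resolvent P M ε g).trace) ^ 2) ∂stdNormal ι κ ≤
      ∫ g, centredForm (1 - (2 : ℝ) • P) g ^ 2 ∂stdNormal ι κ := by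
  set H : Matrix ι ι ℝ := 1 - (2 : ℝ) • P with hH
  have hq : (0 : ℝ) < Fintype.card κ := by exact_mod_cast hκ
  have hHt : Hᵀ = H := by simp [hH, hPt]
  have hHP : H * P = -P := by
    rw [hH, Matrix.sub_mul, Matrix.one_mul, Matrix.smul_mul, hPP, two_smul]; abel
  -- Positivity of `c` even gives `tr P > 2q + 2`.
  have hq2 : (Fintype.card κ : ℝ) + 2 ≤ P.trace := by
    rw [hc, lt_div_iff₀ hq] at hc0
    linarith
  have hD : HasAllMoments (stdNormal ι κ) (centredForm H) := hasAllMoments_centredForm H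
  have hf : HasAllMoments (stdNormal ι κ) fun g => (resolvent P M ε g).trace :=
    (hasMatMoments_resolvent hPt hPP M hε).trace
  have hdiv : ∀ g, c * ((resolvent P M ε g).trace * (resolvent P M ε g).trace) ≤
      2 * ∑ a, ∑ i, fieldDeriv P M ε g a i a i := fun g => by
    rw [sum_fieldDeriv hPt hPP M hε g rfl rfl]
    have h := div_lower_bound (posSemidef_gram hPt hPP M g) hε
      (V := resolvent P M ε g) rfl hq2
    rw [hc, div_mul_eq_mul_div, div_le_iff₀ hq]
    linarith
  have hmain : c * ∫ g, (resolvent P M ε g).trace * (resolvent P M ε g).trace ∂stdNormal ι κ ≤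
      ∫ g, centredForm H g * (resolvent P M ε g).trace ∂stdNormal ι κ := by
    rw [integral_centredForm_mul_trace hPt hPP hHt hHP M hε, ← integral_const_mul]
    refine integral_mono_of_nonneg (Filter.Eventually.of_forall fun g =>
      mul_nonneg hc0.le (mul_self_nonneg _)) ?_ (Filter.Eventually.of_forall hdiv)
    exact ((HasAllMoments.sum _ fun a => HasAllMoments.sum _ fun i =>
      hasMatMoments_fieldDeriv hPt hPP M hε a i a i).const_mul 2).integrable
  have e1 : ∀ g, (centredForm H g - c * (resolvent P M ε g).trace) ^ 2
        + (c * (resolvent P M ε g).trace) ^ 2 = centredForm H g * centredForm H g -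
        2 * c * (centredForm H g * (resolvent P M ε g).trace
          - c * ((resolvent P M ε g).trace * (resolvent P M ε g).trace)) := fun g => by ring
  simp_rw [e1]
  rw [integral_sub (hD.mul hD).integrable
    ((((hD.mul hf).sub ((hf.mul hf).const_mul c)).const_mul (2 * c)).integrable),
    integral_const_mul, integral_sub (hD.mul hf).integrable ((hf.mul hf).const_mul c).integrable,
    integral_const_mul]
  simp only [pow_two]
  have : 0 ≤ 2 * c * (∫ g, centredForm H g * (resolvent P M ε g).trace ∂stdNormal ι κ -
      c * ∫ g, (resolvent P M ε g).trace * (resolvent P M ε g).trace ∂stdNormal ι κ) :=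
    mul_nonneg (by positivity) (by linarith)
  linarith

/-- Subtracting a multiple of the trace of the inverse Gram matrix strictly reduces the mean
square of the centred quadratic form. -/
theorem lintegral_sq_sub_lt {P : Matrix ι ι ℝ} (hPt : Pᵀ = P) (hPP : P * P = P)
    (M : Matrix ι κ ℝ) (hκ : 0 < Fintype.card κ) {c : ℝ}
    (hc : c = 2 * (P.trace - 2 * Fintype.card κ - 2) / Fintype.card κ) (hc0 : 0 < c) :
    ∫⁻ g, ENNReal.ofReal ((centredForm (1 - (2 : ℝ) • P) g - c * ((gram P M g)⁻¹).trace) ^ 2)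
        ∂stdNormal ι κ <
      ∫⁻ g, ENNReal.ofReal (centredForm (1 - (2 : ℝ) • P) g ^ 2) ∂stdNormal ι κ := by
  have : Nonempty κ := Fintype.card_pos_iff.1 hκ
  set H : Matrix ι ι ℝ := 1 - (2 : ℝ) • P with hH
  set D : (ι → κ → ℝ) → ℝ := centredForm H with hDdef
  set T : (ι → κ → ℝ) → ℝ := fun g => ((gram P M g)⁻¹).trace with hT
  set f : ℕ → (ι → κ → ℝ) → ℝ := fun k g => (resolvent P M (1 / ((k : ℝ) + 1)) g).trace with hf
  -- The gain that survives the limit. The value `1` on the singular set is an arbitrary positive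
  -- number, so that `h` is positive everywhere and the size of that set is irrelevant.
  set h : (ι → κ → ℝ) → ℝ := fun g => if (gram P M g).det = 0 then 1 else (c * T g) ^ 2 with hh
  set u : ℕ → (ι → κ → ℝ) → ℝ := fun k g => (D g - c * f k g) ^ 2 + (c * f k g) ^ 2 with hu
  have hDm : Measurable D := (continuous_centredForm H).measurable
  have hTm : Measurable T :=
    Finset.measurable_sum _ fun i _ => measurable_inv_apply (continuous_gram P M) i i
  have hfm : ∀ k, Measurable (f k) := fun k =>
    Finset.measurable_sum _ fun i _ => measurable_resolvent_apply P M _ i i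
  have hhm : Measurable h :=
    Measurable.ite ((continuous_gram P M).matrix_det.measurable (measurableSet_singleton 0))
      measurable_const ((hTm.const_mul c).pow_const 2)
  have hum : ∀ k, Measurable (u k) := fun k =>
    ((hDm.sub ((hfm k).const_mul c)).pow_const 2).add (((hfm k).const_mul c).pow_const 2)
  have hDall : HasAllMoments (stdNormal ι κ) D := hasAllMoments_centredForm H
  have hD2 : Integrable (fun g => D g ^ 2) (stdNormal ι κ) := by
    simpa only [pow_two] using (hDall.mul hDall).integrable
  have hhpos : ∀ g, 0 < h g := fun g => by
    simp only [hh]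
    split_ifs with hdet
    · exact one_pos
    · have hPD : (gram P M g).PosDef :=
        (posSemidef_gram hPt hPP M g).posDef_iff_isUnit.2
          ((Matrix.isUnit_iff_isUnit_det _).2 (isUnit_iff_ne_zero.2 hdet))
      have : 0 < T g := hPD.inv.trace_pos
      positivity
  have hk : ∀ k : ℕ, (0 : ℝ) < 1 / ((k : ℝ) + 1) := fun k => by positivity
  have hule : ∀ k, ∫⁻ g, ENNReal.ofReal (u k g) ∂stdNormal ι κ ≤
      ∫⁻ g, ENNReal.ofReal (D g ^ 2) ∂stdNormal ι κ := fun k => by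
    have hfall : HasAllMoments (stdNormal ι κ) (f k) :=
      (hasMatMoments_resolvent hPt hPP M (hk k)).trace
    have hui : Integrable (u k) (stdNormal ι κ) := by
      simp only [hu, pow_two]
      exact (((hDall.sub (hfall.const_mul c)).mul (hDall.sub (hfall.const_mul c))).add
        ((hfall.const_mul c).mul (hfall.const_mul c))).integrable
    rw [← ofReal_integral_eq_lintegral_ofReal hui (Filter.Eventually.of_forall fun g => by
        simp only [hu, Pi.zero_apply]; positivity),
      ← ofReal_integral_eq_lintegral_ofReal hD2 (Filter.Eventually.of_forall fun g => by
        simp only [Pi.zero_apply]; positivity)]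
    exact ENNReal.ofReal_le_ofReal (integral_sq_sub_add_le hPt hPP M hκ hc hc0 (hk k))
  have hpt : ∀ g, ENNReal.ofReal ((D g - c * T g) ^ 2 + h g) ≤
      Filter.liminf (fun k => ENNReal.ofReal (u k g)) Filter.atTop := fun g => by
    by_cases hdet : (gram P M g).det = 0
    · have hT0 : T g = 0 := by
        simp [hT, Matrix.nonsing_inv_apply_not_isUnit _ (by simp [hdet] : ¬IsUnit (gram P M g).det)]
      refine Filter.le_liminf_of_le (by isBoundedDefault) ?_
      -- From `m` on, `f k g ≥ k + 1` gives `c² f ≥ D² + 1`; since `f ≥ 1`, also `(c f)² ≥ D² + 1`,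
      -- which is the required value because `T g = 0` here.
      obtain ⟨m, hm⟩ := exists_nat_ge ((D g ^ 2 + 1) / c ^ 2)
      filter_upwards [Filter.eventually_ge_atTop m] with k hkm
      refine ENNReal.ofReal_le_ofReal ?_
      have h1 : (k : ℝ) + 1 ≤ f k g := by
        have := inv_le_trace_resolvent_of_det_eq_zero (posSemidef_gram hPt hPP M g) hdet (hk k)
        simpa [hf, resolvent] using this
      have h2 : (D g ^ 2 + 1) / c ^ 2 ≤ f k g := by
        have : (m : ℝ) ≤ k := by exact_mod_cast hkm
        linarith
      rw [div_le_iff₀ (by positivity)] at h2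
      have h3 : f k g ≤ f k g ^ 2 := by
        have : (0 : ℝ) ≤ k := by positivity
        nlinarith
      have h4 : D g ^ 2 + 1 ≤ (c * f k g) ^ 2 := by
        rw [mul_pow, mul_comm]
        exact h2.trans (by gcongr)
      simp only [hh, hdet, if_true, hT0, mul_zero, sub_zero, hu]
      nlinarith [sq_nonneg (D g - c * f k g)]
    · have h1 : Filter.Tendsto (fun k => f k g) Filter.atTop (nhds (T g)) :=
        tendsto_trace_resolvent
          ((Matrix.isUnit_iff_isUnit_det _).2 (isUnit_iff_ne_zero.2 hdet))
      have h2 : Filter.Tendsto (fun k => ENNReal.ofReal (u k g)) Filter.atTop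
          (nhds (ENNReal.ofReal ((D g - c * T g) ^ 2 + (c * T g) ^ 2))) :=
        ENNReal.tendsto_ofReal ((((h1.const_mul c).const_sub (D g)).pow 2).add
          ((h1.const_mul c).pow 2))
      rw [h2.liminf_eq]
      simp [hh, hdet]
  have hsum : ∫⁻ g, ENNReal.ofReal ((D g - c * T g) ^ 2) ∂stdNormal ι κ
      + ∫⁻ g, ENNReal.ofReal (h g) ∂stdNormal ι κ ≤
      ∫⁻ g, ENNReal.ofReal (D g ^ 2) ∂stdNormal ι κ := by
    rw [← lintegral_add_right _ hhm.ennreal_ofReal]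
    simp_rw [← ENNReal.ofReal_add (sq_nonneg _) (hhpos _).le]
    -- Fatou's lemma, followed by the bound uniform in `k`.
    refine (lintegral_mono hpt).trans
      ((lintegral_liminf_le fun k => (hum k).ennreal_ofReal).trans ?_)
    exact Filter.liminf_le_of_le (by isBoundedDefault) fun b hb => by
      obtain ⟨k, hk⟩ := hb.exists
      exact hk.trans (hule k)
  have hpos : 0 < ∫⁻ g, ENNReal.ofReal (h g) ∂stdNormal ι κ := by
    rw [lintegral_pos_iff_support hhm.ennreal_ofReal]
    have : (Function.support fun g => ENNReal.ofReal (h g)) = Set.univ := by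
      ext g; simp [hhpos g]
    simp [this]
  have hfin : ∫⁻ g, ENNReal.ofReal (D g ^ 2) ∂stdNormal ι κ ≠ ∞ := by
    rw [← ofReal_integral_eq_lintegral_ofReal hD2 (Filter.Eventually.of_forall fun g =>
      sq_nonneg _)]
    exact ENNReal.ofReal_ne_top
  -- Finiteness is needed to make adding a positive amount strict; it comes from the inequality
  -- itself.
  have hfin' : ∫⁻ g, ENNReal.ofReal ((D g - c * T g) ^ 2) ∂stdNormal ι κ ≠ ∞ :=
    ne_top_of_le_ne_top hfin (le_self_add.trans hsum)
  exact (ENNReal.lt_add_right hfin' hpos.ne').trans_le hsum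

end

end GaussianMatrix

/-! ### Reduction of the regression model to a standard normal matrix -/

namespace Regression

open GaussianMatrix

variable {n p q : ℕ}

/-- The orthogonal projection onto the column space of the design matrix. -/
noncomputable def hatMatrix (X : Matrix (Fin n) (Fin p) ℝ) : Matrix (Fin n) (Fin n) ℝ :=
  X * (Xᵀ * X)⁻¹ * Xᵀ

section hatMatrix

variable (X : Matrix (Fin n) (Fin p) ℝ)

theorem hatMatrix_transpose : (hatMatrix X)ᵀ = hatMatrix X := by
  simp [hatMatrix, transpose_nonsing_inv, Matrix.mul_assoc]

theorem mul_mle (y : Sample n q) : X * mle X y = hatMatrix X * responseMatrix y := by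
  simp [mle, hatMatrix, Matrix.mul_assoc]

variable {X}

/-- `Xᵀ X` has the rank of `X`, here `p`, so its range is the whole space. -/
theorem isUnit_det_transpose_mul_self (hX : X.rank = p) : IsUnit (Xᵀ * X).det := by
  rw [← Matrix.isUnit_iff_isUnit_det, ← Matrix.mulVec_surjective_iff_isUnit]
  suffices h : LinearMap.range (Xᵀ * X).mulVecLin = ⊤ from LinearMap.range_eq_top.1 h
  refine Submodule.eq_top_of_finrank_eq ?_
  have h := Matrix.rank_transpose_mul_self X
  rw [Matrix.rank, hX] at h
  simpa using h

theorem hatMatrix_mul_self (hX : X.rank = p) : hatMatrix X * X = X := by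
  rw [hatMatrix, Matrix.mul_assoc, Matrix.mul_assoc,
    Matrix.nonsing_inv_mul _ (isUnit_det_transpose_mul_self hX), Matrix.mul_one]

theorem hatMatrix_mul_hatMatrix (hX : X.rank = p) : hatMatrix X * hatMatrix X = hatMatrix X := by
  conv_lhs => enter [2]; rw [hatMatrix]
  rw [← Matrix.mul_assoc, ← Matrix.mul_assoc, hatMatrix_mul_self hX, hatMatrix]

theorem trace_hatMatrix (hX : X.rank = p) : (hatMatrix X).trace = p := by
  rw [hatMatrix, Matrix.trace_mul_comm, ← Matrix.mul_assoc,
    Matrix.mul_nonsing_inv _ (isUnit_det_transpose_mul_self hX), Matrix.trace_one,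
    Fintype.card_fin]

end hatMatrix

/-- The sample with mean `X B` and noise `G A`. -/
noncomputable def noisySample (X : Matrix (Fin n) (Fin p) ℝ) (A : Matrix (Fin q) (Fin q) ℝ)
    (B : Matrix (Fin p) (Fin q) ℝ) (g : Fin n → Fin q → ℝ) : Sample n q :=
  fun i => meanVector X B i + toEuclideanCLM (𝕜 := ℝ) A (WithLp.toLp 2 (g i))

theorem measurable_noisySample (X : Matrix (Fin n) (Fin p) ℝ) (A : Matrix (Fin q) (Fin q) ℝ)
    (B : Matrix (Fin p) (Fin q) ℝ) : Measurable (noisySample X A B) := by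
  unfold noisySample
  fun_prop

open scoped MatrixOrder in
theorem law_eq_map (X : Matrix (Fin n) (Fin p) ℝ) (S : Matrix (Fin q) (Fin q) ℝ)
    (B : Matrix (Fin p) (Fin q) ℝ) :
    law X S B = (stdNormal (Fin n) (Fin q)).map (noisySample X (CFC.sqrt S) B) := by
  unfold law stdNormal noisySample
  rw [Measure.pi_map_pi (f := fun i v => meanVector X B i
    + toEuclideanCLM (𝕜 := ℝ) (CFC.sqrt S) (WithLp.toLp 2 v)) (fun i => by fun_prop)]
  congr 1 with i : 1
  rw [multivariateGaussian, ← map_pi_eq_stdGaussian, Measure.map_map (by fun_prop) (by fun_prop)]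
  rfl

theorem responseMatrix_noisySample (X : Matrix (Fin n) (Fin p) ℝ) {A : Matrix (Fin q) (Fin q) ℝ}
    (hA : Aᵀ = A) (B : Matrix (Fin p) (Fin q) ℝ) (g : Fin n → Fin q → ℝ) :
    responseMatrix (noisySample X A B g) = X * B + Matrix.of g * A := by
  ext i j
  have hs : ∀ k, A j k = A k j := fun k => congrFun (congrFun hA k) j
  simp [responseMatrix, noisySample, meanVector, Matrix.mul_apply, mulVec, dotProduct, mul_comm, hs]

/-- The logarithm of the normalising constant of the density of one observation. -/
noncomputable def logNormalizer (S : Matrix (Fin q) (Fin q) ℝ) : ℝ :=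
  Real.log (√((2 * Real.pi) ^ q * S.det))⁻¹

theorem log_density (X : Matrix (Fin n) (Fin p) ℝ) {S : Matrix (Fin q) (Fin q) ℝ}
    (hS : S.PosDef) (B : Matrix (Fin p) (Fin q) ℝ) (y : Sample n q) :
    Real.log (density X S B y) = n * logNormalizer S -
      ((responseMatrix y - X * B) * S⁻¹ * (responseMatrix y - X * B)ᵀ).trace / 2 := by
  have hc : (√((2 * Real.pi) ^ q * S.det))⁻¹ ≠ 0 := by
    have := hS.det_pos
    positivity
  have h : ∀ i, (y i - meanVector X B i).ofLp = (responseMatrix y - X * B) i := fun i => by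
    ext j
    simp [responseMatrix, meanVector, Matrix.mul_apply, mulVec, dotProduct, mul_comm]
  simp only [density, gaussianDensity, h]
  rw [Real.log_prod fun i _ => mul_ne_zero hc (Real.exp_ne_zero _)]
  simp only [Real.log_mul hc (Real.exp_ne_zero _), Real.log_exp, Finset.sum_add_distrib,
    Finset.sum_const, Finset.card_univ, Fintype.card_fin, nsmul_eq_mul, logNormalizer,
    ← Finset.sum_div, Finset.sum_neg_distrib]
  rw [neg_div, ← sub_eq_add_neg]
  congr 2
  simp only [Matrix.trace, Matrix.diag]
  refine Finset.sum_congr rfl fun i _ => ?_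
  rw [Matrix.dotProduct_mulVec, Matrix.mul_apply]
  rfl

open scoped MatrixOrder in
theorem exists_sqrt {S : Matrix (Fin q) (Fin q) ℝ} (hS : S.PosDef) :
    (CFC.sqrt S)ᵀ = CFC.sqrt S ∧ IsUnit (CFC.sqrt S).det ∧ CFC.sqrt S * CFC.sqrt S = S := by
  have h := CFC.sqrt_mul_sqrt_self S hS.posSemidef.nonneg
  refine ⟨(CFC.sqrt_nonneg S).posSemidef.isHermitian, ?_, h⟩
  rw [isUnit_iff_ne_zero]
  intro h0
  have := hS.det_pos
  rw [← h, det_mul, h0] at this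
  simp at this

section standardized

variable {X : Matrix (Fin n) (Fin p) ℝ} {S A : Matrix (Fin q) (Fin q) ℝ}

/-- Whitening: `A S⁻¹ A = 1`, so the Mahalanobis form becomes the Frobenius norm. -/
theorem trace_mul_inv_mul_transpose (hAt : Aᵀ = A) (hA : IsUnit A.det) (hAS : A * A = S)
    (U : Matrix (Fin n) (Fin q) ℝ) :
    ((U * A) * S⁻¹ * (U * A)ᵀ).trace = (Uᵀ * U).trace := by
  have : A * S⁻¹ * A = 1 := by
    rw [← hAS, Matrix.mul_inv_rev, ← Matrix.mul_assoc, Matrix.mul_nonsing_inv _ hA,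
      Matrix.one_mul, Matrix.nonsing_inv_mul _ hA]
  rw [transpose_mul, hAt, Matrix.trace_mul_comm Uᵀ]
  congr 1
  calc U * A * S⁻¹ * (A * Uᵀ) = U * (A * S⁻¹ * A) * Uᵀ := by simp only [Matrix.mul_assoc]
    _ = U * Uᵀ := by rw [this, Matrix.mul_one]

theorem log_density_noisySample (hS : S.PosDef) (hAt : Aᵀ = A) (hA : IsUnit A.det)
    (hAS : A * A = S) (B B' : Matrix (Fin p) (Fin q) ℝ) {K : Matrix (Fin n) (Fin q) ℝ}
    (hK : X * B - X * B' = K * A) (g : Fin n → Fin q → ℝ) :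
    Real.log (density X S B' (noisySample X A B g)) = n * logNormalizer S -
      ((K + Matrix.of g)ᵀ * (K + Matrix.of g)).trace / 2 := by
  have h : X * B + Matrix.of g * A - X * B' = (K + Matrix.of g) * A := by
    rw [Matrix.add_mul, ← hK]; abel
  rw [log_density X hS, responseMatrix_noisySample X hAt, h,
    trace_mul_inv_mul_transpose hAt hA hAS]

/-- The cross terms vanish in mean and each of the `n q` entries has second moment `1`; both follow
from integration by parts, with a constant and with the entry itself. -/
theorem integral_trace_transpose_mul_self (K : Matrix (Fin n) (Fin q) ℝ) :
    ∫ g, ((K + Matrix.of g)ᵀ * (K + Matrix.of g)).trace ∂stdNormal (Fin n) (Fin q) =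
      (Kᵀ * K).trace + n * q := by
  have hg : ∀ (a : Fin n) (i : Fin q), ∫ g : Fin n → Fin q → ℝ, g a i ∂stdNormal (Fin n) (Fin q) = 0 :=
    fun a i => by
      have := integral_entry_mul a i (F := fun _ => 1) (F' := fun _ => 0) (.const _) (.const _)
        fun g => hasDerivAt_const _ _
      simpa using this
  have hg2 : ∀ (a : Fin n) (i : Fin q),
      ∫ g : Fin n → Fin q → ℝ, g a i * g a i ∂stdNormal (Fin n) (Fin q) = 1 := fun a i => by
    have := integral_entry_mul a i (F := fun g => g a i) (F' := fun _ => unit a i a i)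
      (hasAllMoments_entry a i) (.const _) fun g => hasLineDerivAt_entry a a i i g
    simpa [unit_apply] using this
  have hi := fun (a : Fin n) (i : Fin q) => hasAllMoments_entry a i
  have he : ∀ (a : Fin n) (i : Fin q), HasAllMoments (stdNormal (Fin n) (Fin q))
      fun g => K a i * K a i + 2 * K a i * g a i + g a i * g a i := fun a i =>
    ((HasAllMoments.const _).add ((hi a i).const_mul _)).add ((hi a i).mul (hi a i))
  have h1 : ∀ g : Fin n → Fin q → ℝ, ((K + Matrix.of g)ᵀ * (K + Matrix.of g)).trace =
      ∑ a, ∑ i, (K a i * K a i + 2 * K a i * g a i + g a i * g a i) := fun g => by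
    rw [trace_transpose_mul_eq_sum]
    refine Finset.sum_congr rfl fun a _ => Finset.sum_congr rfl fun i _ => ?_
    simp only [Matrix.add_apply, of_apply]
    ring
  simp_rw [h1]
  rw [integral_finsetSum _ fun a _ => integrable_finsetSum _ fun i _ => (he a i).integrable]
  have h2 : ∀ (a : Fin n) (i : Fin q), ∫ g : Fin n → Fin q → ℝ,
      (K a i * K a i + 2 * K a i * g a i + g a i * g a i) ∂stdNormal (Fin n) (Fin q) =
        K a i * K a i + 1 := fun a i => by
    rw [integral_add (((HasAllMoments.const _).add ((hi a i).const_mul _)).integrable)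
      ((hi a i).mul (hi a i)).integrable, integral_add (integrable_const _)
      ((hi a i).const_mul _).integrable, integral_const_mul (2 * K a i), hg, hg2]
    simp
  simp_rw [integral_finsetSum _ fun i _ => (he _ i).integrable, h2, Finset.sum_add_distrib,
    ← trace_transpose_mul_eq_sum]
  simp

theorem measurable_density (X : Matrix (Fin n) (Fin p) ℝ) (S : Matrix (Fin q) (Fin q) ℝ)
    (B : Matrix (Fin p) (Fin q) ℝ) : Measurable (density X S B) := by
  unfold density gaussianDensity
  fun_prop

-- The integral against the density is an expectation under the law, hence under the standard normal
-- matrix. `K` is the whitened difference of the means.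
open scoped MatrixOrder in
theorem klDiscrepancy_density (hS : S.PosDef) (B B' : Matrix (Fin p) (Fin q) ℝ)
    {K : Matrix (Fin n) (Fin q) ℝ} (hK : X * B - X * B' = K * CFC.sqrt S) :
    LossEstimation.klDiscrepancy (density X S B) (density X S B') =
      -2 * (n * logNormalizer S) + (Kᵀ * K).trace + n * q := by
  obtain ⟨hAt, hA, hAS⟩ := exists_sqrt hS
  have h0 : ∀ y, 0 ≤ density X S B y := fun y => by
    unfold density gaussianDensity; positivity
  have h1 : ∫ y, density X S B y * Real.log (density X S B' y) =
      ∫ y, Real.log (density X S B' y) ∂law X S B := by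
    rw [law_eq_withDensity X S hS B, integral_withDensity_eq_integral_toReal_smul
      (measurable_density X S B).ennreal_ofReal (by simp)]
    simp only [ENNReal.toReal_ofReal (h0 _), smul_eq_mul]
  have hKi : HasAllMoments (stdNormal (Fin n) (Fin q)) fun g =>
      ((K + Matrix.of g)ᵀ * (K + Matrix.of g)).trace :=
    have h := (HasMatMoments.const K).add hasMatMoments_of
    (h.transpose.mul h).trace
  rw [LossEstimation.klDiscrepancy, h1, law_eq_map, integral_map
    (measurable_noisySample _ _ _).aemeasurable
    (measurable_density X S B').log.aestronglyMeasurable]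
  simp_rw [log_density_noisySample hS hAt hA hAS B B' hK]
  rw [integral_sub (integrable_const _) (hKi.integrable.div_const 2), integral_div,
    integral_trace_transpose_mul_self]
  simp
  ring

end standardized

variable {X : Matrix (Fin n) (Fin p) ℝ} {S : Matrix (Fin q) (Fin q) ℝ}

theorem mul_sub_mul_mle (hX : X.rank = p) {A : Matrix (Fin q) (Fin q) ℝ} (hAt : Aᵀ = A)
    (B : Matrix (Fin p) (Fin q) ℝ) (g : Fin n → Fin q → ℝ) :
    X * B - X * mle X (noisySample X A B g) = -(hatMatrix X * Matrix.of g) * A := by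
  rw [mul_mle, responseMatrix_noisySample X hAt, Matrix.mul_add, ← Matrix.mul_assoc,
    hatMatrix_mul_self hX, Matrix.neg_mul, Matrix.mul_assoc]
  abel

open scoped MatrixOrder in
theorem discrepancy_noisySample (hX : X.rank = p) (hS : S.PosDef) (B : Matrix (Fin p) (Fin q) ℝ)
    (g : Fin n → Fin q → ℝ) :
    discrepancy X S B (noisySample X (CFC.sqrt S) B g) = -2 * (n * logNormalizer S)
      + ((Matrix.of g)ᵀ * (hatMatrix X * Matrix.of g)).trace + n * q := by
  rw [discrepancy, klDiscrepancy_density hS B _ (mul_sub_mul_mle hX (exists_sqrt hS).1 B g)]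
  congr 3
  rw [transpose_neg, Matrix.neg_mul, Matrix.mul_neg, neg_neg, transpose_mul, hatMatrix_transpose, Matrix.mul_assoc,
    ← Matrix.mul_assoc (hatMatrix X), hatMatrix_mul_hatMatrix hX]

open scoped MatrixOrder in
theorem AIC_noisySample (hX : X.rank = p) (hS : S.PosDef) (B : Matrix (Fin p) (Fin q) ℝ)
    (g : Fin n → Fin q → ℝ) :
    AIC X S (noisySample X (CFC.sqrt S) B g) = -2 * (n * logNormalizer S)
      + ((Matrix.of g)ᵀ * Matrix.of g).trace
      - ((Matrix.of g)ᵀ * (hatMatrix X * Matrix.of g)).trace + 2 * (p * q) := by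
  obtain ⟨hAt, hA, hAS⟩ := exists_sqrt hS
  rw [AIC, log_density_noisySample hS hAt hA hAS B _ (mul_sub_mul_mle hX hAt B g)]
  have h : (-(hatMatrix X * Matrix.of g) + Matrix.of g)ᵀ
      * (-(hatMatrix X * Matrix.of g) + Matrix.of g) =
      (Matrix.of g)ᵀ * Matrix.of g - (Matrix.of g)ᵀ * (hatMatrix X * Matrix.of g) := by
    have h1 : (Matrix.of g)ᵀ * hatMatrix X * (hatMatrix X * Matrix.of g) =
        (Matrix.of g)ᵀ * (hatMatrix X * Matrix.of g) := by
      rw [Matrix.mul_assoc, ← Matrix.mul_assoc (hatMatrix X), hatMatrix_mul_hatMatrix hX]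
    simp only [transpose_add, transpose_neg, transpose_mul, hatMatrix_transpose, Matrix.add_mul,
      Matrix.mul_add, Matrix.neg_mul, Matrix.mul_neg, h1]
    rw [Matrix.mul_assoc]
    abel
  rw [h, Matrix.trace_sub]
  ring

-- The normalising constants cancel, and `2pq - nq` is exactly `-q tr(1 - 2P)` since `tr P = p`: AIC
-- is unbiased, and its error does not involve `B`.
open scoped MatrixOrder in
theorem AIC_sub_discrepancy (hX : X.rank = p) (hS : S.PosDef) (B : Matrix (Fin p) (Fin q) ℝ)
    (g : Fin n → Fin q → ℝ) :
    AIC X S (noisySample X (CFC.sqrt S) B g)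
        - discrepancy X S B (noisySample X (CFC.sqrt S) B g) =
      centredForm (1 - (2 : ℝ) • hatMatrix X) g := by
  rw [AIC_noisySample hX hS, discrepancy_noisySample hX hS, centredForm]
  simp only [Matrix.sub_mul, Matrix.one_mul, Matrix.smul_mul, Matrix.mul_sub, Matrix.mul_smul,
    Matrix.trace_sub, Matrix.trace_smul, Matrix.trace_one, trace_hatMatrix hX, smul_eq_mul,
    Fintype.card_fin]
  ring

-- The fitted Gram matrix is `A W A` and `S = A A`, so the factors cancel cyclically under the
-- trace. Reversal of inverses needs no invertibility of `W`.
open scoped MatrixOrder in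
theorem trace_mul_inv_noisySample (hX : X.rank = p) (hS : S.PosDef)
    (B : Matrix (Fin p) (Fin q) ℝ) (g : Fin n → Fin q → ℝ) :
    (S * ((X * mle X (noisySample X (CFC.sqrt S) B g))ᵀ
        * (X * mle X (noisySample X (CFC.sqrt S) B g)))⁻¹).trace =
      ((gram (hatMatrix X) (X * B * (CFC.sqrt S)⁻¹) g)⁻¹).trace := by
  obtain ⟨hAt, hA, hAS⟩ := exists_sqrt hS
  set A := CFC.sqrt S
  have h1 : X * mle X (noisySample X A B g) =
      hatMatrix X * (X * B * A⁻¹ + Matrix.of g) * A := by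
    rw [mul_mle, responseMatrix_noisySample X hAt, Matrix.mul_assoc, Matrix.add_mul,
      Matrix.mul_assoc (X * B), Matrix.nonsing_inv_mul _ hA, Matrix.mul_one]
  rw [h1, gram_eq (hatMatrix_transpose X) (hatMatrix_mul_hatMatrix hX)]
  set K := hatMatrix X * (X * B * A⁻¹ + Matrix.of g)
  rw [transpose_mul, hAt, Matrix.mul_assoc A, ← Matrix.mul_assoc Kᵀ, Matrix.mul_inv_rev,
    Matrix.mul_inv_rev, ← hAS]
  have h2 : A * A * (A⁻¹ * (Kᵀ * K)⁻¹ * A⁻¹) = A * ((Kᵀ * K)⁻¹ * A⁻¹) := by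
    rw [Matrix.mul_assoc A A, Matrix.mul_assoc A⁻¹, ← Matrix.mul_assoc A A⁻¹,
      Matrix.mul_nonsing_inv _ hA, Matrix.one_mul]
  rw [h2, Matrix.trace_mul_comm, Matrix.mul_assoc, Matrix.nonsing_inv_mul _ hA, Matrix.mul_one]

/-! ### Measurability and transfer of the risk -/

theorem continuous_responseMatrix :
    Continuous (responseMatrix : Sample n q → Matrix (Fin n) (Fin q) ℝ) :=
  continuous_matrix fun i j => by unfold responseMatrix; simp only [of_apply]; fun_prop

theorem continuous_mul_mle (X : Matrix (Fin n) (Fin p) ℝ) :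
    Continuous fun y : Sample n q => X * mle X y := by
  simp_rw [mul_mle]
  exact continuous_const.matrix_mul continuous_responseMatrix

theorem measurable_AIC (X : Matrix (Fin n) (Fin p) ℝ) (hS : S.PosDef) :
    Measurable (AIC X S) := by
  unfold AIC
  simp_rw [log_density X hS]
  have h : Continuous fun y : Sample n q => responseMatrix y - X * mle X y :=
    continuous_responseMatrix.sub (continuous_mul_mle X)
  have h1 : Continuous fun y : Sample n q =>
      ((responseMatrix y - X * mle X y) * S⁻¹ * (responseMatrix y - X * mle X y)ᵀ).trace :=
    ((h.matrix_mul continuous_const).matrix_mul h.matrix_transpose).matrix_trace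
  have := h1.measurable
  fun_prop

theorem measurable_MAIC (X : Matrix (Fin n) (Fin p) ℝ) (hS : S.PosDef) :
    Measurable (MAIC X S) := by
  unfold MAIC
  have h1 := measurable_AIC X hS
  have h2 : ∀ i j, Measurable fun y : Sample n q => ((X * mle X y)ᵀ * (X * mle X y))⁻¹ i j :=
    measurable_inv_apply
      ((continuous_mul_mle X).matrix_transpose.matrix_mul (continuous_mul_mle X))
  have h3 : Measurable fun y : Sample n q =>
      (S * ((X * mle X y)ᵀ * (X * mle X y))⁻¹).trace := by
    simp only [Matrix.trace, Matrix.diag, Matrix.mul_apply (M := S)]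
    exact Finset.measurable_sum _ fun i _ => Finset.measurable_sum _ fun j _ =>
      (h2 j i).const_mul _
  fun_prop

open scoped MatrixOrder in
theorem measurable_discrepancy (X : Matrix (Fin n) (Fin p) ℝ) (hS : S.PosDef)
    (B : Matrix (Fin p) (Fin q) ℝ) : Measurable (discrepancy X S B) := by
  obtain ⟨hAt, hA, hAS⟩ := exists_sqrt hS
  -- As `√S` is invertible, the whitened difference exists for each sample and depends continuously
  -- on it; the closed form of the discrepancy then replaces the parametric integral.
  have hK : ∀ y : Sample n q, X * B - X * mle X y =
      (X * B - X * mle X y) * (CFC.sqrt S)⁻¹ * CFC.sqrt S := fun y => by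
    rw [Matrix.mul_assoc, Matrix.nonsing_inv_mul _ hA, Matrix.mul_one]
  have h : Continuous fun y : Sample n q => (X * B - X * mle X y) * (CFC.sqrt S)⁻¹ :=
    (continuous_const.sub (continuous_mul_mle X)).matrix_mul continuous_const
  have h1 := (h.matrix_transpose.matrix_mul h).matrix_trace.measurable
  unfold discrepancy
  simp_rw [fun y => klDiscrepancy_density hS B _ (hK y)]
  fun_prop

open scoped MatrixOrder in
theorem risk_eq_lintegral (X : Matrix (Fin n) (Fin p) ℝ) (hS : S.PosDef)
    (B : Matrix (Fin p) (Fin q) ℝ) {l : Sample n q → ℝ} (hl : Measurable l) :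
    LossEstimation.risk (law X S) (discrepancy X S) l B =
      ∫⁻ g, ENNReal.ofReal ((l (noisySample X (CFC.sqrt S) B g)
        - discrepancy X S B (noisySample X (CFC.sqrt S) B g)) ^ 2)
          ∂stdNormal (Fin n) (Fin q) := by
  have h : Measurable fun y => ENNReal.ofReal ((l y - discrepancy X S B y) ^ 2) :=
    ((hl.sub (measurable_discrepancy X hS B)).pow_const 2).ennreal_ofReal
  rw [LossEstimation.risk, law_eq_map, lintegral_map h (measurable_noisySample _ _ _)]

open scoped MatrixOrder in
theorem risk_MAIC_lt_risk_AIC (hq : 1 ≤ q) (hp : 2 * q + 3 ≤ p) (hX : X.rank = p)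
    (hS : S.PosDef) (B : Matrix (Fin p) (Fin q) ℝ) :
    LossEstimation.risk (law X S) (discrepancy X S) (MAIC X S) B <
      LossEstimation.risk (law X S) (discrepancy X S) (AIC X S) B := by
  rw [risk_eq_lintegral X hS B (measurable_MAIC X hS),
    risk_eq_lintegral X hS B (measurable_AIC X hS)]
  have hM : ∀ g, MAIC X S (noisySample X (CFC.sqrt S) B g)
      - discrepancy X S B (noisySample X (CFC.sqrt S) B g) =
      centredForm (1 - (2 : ℝ) • hatMatrix X) g - 2 * ((p : ℝ) - 2 * q - 2) / q *
        ((gram (hatMatrix X) (X * B * (CFC.sqrt S)⁻¹) g)⁻¹).trace := fun g => by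
    rw [MAIC, trace_mul_inv_noisySample hX hS, ← AIC_sub_discrepancy hX hS B]
    ring
  simp_rw [hM, AIC_sub_discrepancy hX hS B]
  have hp' : (2 : ℝ) * q + 3 ≤ p := by exact_mod_cast hp
  have hq' : (0 : ℝ) < q := by exact_mod_cast hq
  exact lintegral_sq_sub_lt (hatMatrix_transpose X) (hatMatrix_mul_hatMatrix hX) _
    (by simpa using Nat.pos_of_ne_zero (by lia)) (by rw [trace_hatMatrix hX, Fintype.card_fin])
    (div_pos (by linarith) hq')

end Regression

theorem mainTheorem4 (n p q : ℕ) (hq : 1 ≤ q) (hp : 2 * q + 3 ≤ p)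
    (X : Matrix (Fin n) (Fin p) ℝ) (hX : X.rank = p)
    (S : Matrix (Fin q) (Fin q) ℝ) (hS : S.PosDef) :
    LossEstimation.IsInadmissible (Regression.law X S) (Regression.discrepancy X S)
        (Regression.AIC X S) ∧
      LossEstimation.Dominates (Regression.law X S) (Regression.discrepancy X S)
        (Regression.MAIC X S) (Regression.AIC X S) ∧
      ∀ B : Matrix (Fin p) (Fin q) ℝ,
        LossEstimation.risk (Regression.law X S) (Regression.discrepancy X S)
            (Regression.MAIC X S) B <
          LossEstimation.risk (Regression.law X S) (Regression.discrepancy X S)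
            (Regression.AIC X S) B := by
  have hlt := Regression.risk_MAIC_lt_risk_AIC hq hp hX hS
  have hdom : LossEstimation.Dominates (Regression.law X S) (Regression.discrepancy X S)
      (Regression.MAIC X S) (Regression.AIC X S) :=
    ⟨Regression.measurable_MAIC X hS, Regression.measurable_AIC X hS, fun B => (hlt B).le,
      0, hlt 0⟩
  exact ⟨fun h => h ⟨_, hdom⟩, hdom, hlt⟩
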